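/- Let $r>3$ be an integer and let $V_1,V_2\in C^{r+1}(\mathbb R)$, $V_r\in C^{r+1}(\mathbb R^2)$, where each $V_i$ has finitely many critical points, all non-degenerate, is bounded below, and $V_i(q)\to\infty$ as $|q|\to\infty$. Put $H_i=\tfrac12p_i^2+V_i(q_i)$, $H_{int}=H_1+H_2$ and $H_\epsilon=H_{int}+\epsilon V_r(q_1,q_2)$. Consider the impact system on $\{q_1\ge 0\}$ that moves by the Hamiltonian flow of $H_\epsilon$ in $q_1>0$ and is reflected elastically, $S(q_1,p_1,q_2,p_2)=(q_1,-p_1,q_2,p_2)$, at the impassable wall $q_1=0$. A saddle of $V_i$ is a point with $V_i'=0$, $V_i''<0$. Assume the wall is regular: $V_1'(0)\neq0$ and $V_1(0)\ne V_1(s)$ for each saddle $s$ of $V_1$. For $\delta>0$ and $h\in\mathbb R$ let $\mathbb H_i^{R,\delta}(h)$ be the set of $e\in[\min V_i,\,h-\min V_{\bar i}]$ ($\bar i$ the other index) with $|e-V_i(s)|\ge\delta$ for all saddles $s$ of $V_i$ and $|e-(h-V_{\bar i}(s))|\ge\delta$ for all saddles $s$ of $V_{\bar i}$. Fix $\delta,\rho>0$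 and an energy $h$ that is $\delta$-regular with respect to the wall: $V_1(0)\in\mathbb H_1^{R,\delta}(h)$. A leaf is a connected component of a level set of $H_i$ in the $(q_i,p_i)$-plane, $I=\frac1{2\pi}\oint p_2\,dq_2$ is the action of a leaf in the $(q_2,p_2)$-plane, and a branch is a connected component of $\{H_2\in\mathbb H_2^{R,\delta}(h)\}$ in that plane. Let $\mathcal A$ be the set of points $a=(q_1,p_1,q_2,p_2)$ with $H_{int}(a)=h$, $p_1=0$, $q_1>0$, $V_1'(q_1)>0$ (so $\dot p_1<0$ for $\epsilon=0$), whose leaf in the $(q_1,p_1)$-plane meets the wall, with $H_2(q_2,p_2)\in\mathbb H_2^{R,\delta}(h)$, and such that the action $I$ of $(q_2,p_2)$ satisfies $|I-I_{tan}|\ge\rho$ for the action $I_{tan}$ of any leaf $H_2=h-V_1(0)$ in the branch of $(q_2,p_2)$. Then there are $\epsilon_0>0$ and $C$, depending only on $V_1,V_2,V_r,h,\delta,\rho$, such that for every $a\in\mathcal A$ and every $\epsilon$ with $|\epsilon|<\epsilon_0$ the following holds. The impact trajectories of the unperturbed ($\epsilon=0$) and perturbed systems starting at $a$ exist up to their first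 returns to the cross-section $\{p_1=0,\ \dot p_1<0\}$ at times $t_0^{**}$ and $t_\epsilon^{**}$; each has exactly one impact before its return, at times $t_0^*$ and $t_\epsilon^*$, and this impact is transverse; the unperturbed one exists without a further impact up to some time $T_0>t_0^{**}$, with $T_0\ge t_\epsilon^{**}$ and $T_0$ independent of $\epsilon$. Moreover $|t_\epsilon^*-t_0^*|\le C|\epsilon|$. With $\bar t_{min}=\min(t_0^*,t_\epsilon^*)$, $\bar t_{max}=\max(t_0^*,t_\epsilon^*)$, the perturbed trajectory $z_\epsilon$, the unperturbed impact trajectory $z_0^{im}$ and the unperturbed smooth (non-impacting) trajectory $z_0^{sm}$ from $a$ satisfy $$z_\epsilon(t)=z_0^{im}(t)+\epsilon z_1^{im}(t)+O(\epsilon^2),\qquad t\in[0,\bar t_{min}]\cup[\bar t_{max},t_\epsilon^{**}],$$ and for $t\in[\bar t_{min},\bar t_{max}]$ $$z_\epsilon(t)=\begin{cases}z_0^{sm}(t)+\epsilon z_1^{sm}(t)+O(\epsilon^2)&\text{if }\bar t_{min}=t_0^*,\\ \big(q_{1,0}^{sm}(t+\Delta t),\,p_{1,0}^{sm}(t+\Delta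 t),\,q_{2,0}^{sm}(t),\,p_{2,0}^{sm}(t)\big)+O(\epsilon)&\text{if }\bar t_{max}=t_0^*,\end{cases}$$ where every $O(\epsilon^k)$ is bounded in norm by $C|\epsilon|^k$. At an impact time the impact trajectories and $z_1^{im}$ have two values: on $[0,\bar t_{min}]$, and on the window in the case $\bar t_{min}=t_0^*$, the pre-impact parts are used; on $[\bar t_{max},t_\epsilon^{**}]$, and on the window in the case $\bar t_{max}=t_0^*$, the post-impact parts. Here $\Delta t=2\int_{q_{min}}^0\frac{dq}{\sqrt{2(e-V_1(q))}}$, with $e=H_1(a)$ and $q_{min}$ the leftmost point of the leaf of $a$ in the $(q_1,p_1)$-plane. With $X_H$ denoting the Hamiltonian vector field of $H$, the function $z_1^{sm}$ solves $\dot w=DX_{H_{int}}(z)w+X_{V_r}(z)$, $w(0)=0$, along $z=z_0^{sm}$. The function $z_1^{im}$ solves the same equation along $z=z_0^{im}$ before and after $t_0^*$, vanishes at time $0$, and jumps at $t_0^*$ according to $$w^+=Sw^-+\tau\big(S X_{H_{int}}(z^-)-X_{H_{int}}(z^+)\big),\qquad \tau=-\frac{w^-_{q_1}}{z^-_{p_1}},$$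 with $z^\pm,w^\pm$ the post- and pre-impact values of $z_0^{im},z_1^{im}$. -/

import Mathlib

open Set Filter Topology

noncomputable section

namespace ImpactSystem

/-! ### One-degree-of-freedom mechanical systems `p ^ 2 / 2 + V q` -/

/-- The energy `p ^ 2 / 2 + V q` at the point `w = (q, p)` of the phase plane. -/
def energy (V : ℝ → ℝ) (w : ℝ × ℝ) : ℝ := w.2 ^ 2 / 2 + V w.1

/-- The positions of the saddle fixed points: the non-degenerate local maxima of the potential. -/
def saddles (V : ℝ → ℝ) : Set ℝ := {q | deriv V q = 0 ∧ deriv (deriv V) q < 0}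

/-- One separated potential of an S3B system: smooth (`C ^ (r + 1)`), simple (finitely many
extremal points, all of them non-degenerate), bounded below, with bounded level sets. -/
structure IsS3B (r : ℕ) (V : ℝ → ℝ) : Prop where
  smooth : ContDiff ℝ (r + 1) V
  finite_crit : {q | deriv V q = 0}.Finite
  nondegenerate : ∀ q, deriv V q = 0 → deriv (deriv V) q ≠ 0
  bddBelow : BddBelow (range V)
  coercive : Tendsto V (cocompact ℝ) atTop

/-- The wall `q₁ = 0` is in regular position with respect to `V₁`. -/
def RegularWall (V₁ : ℝ → ℝ) : Prop :=
  deriv V₁ 0 ≠ 0 ∧ ∀ s ∈ saddles V₁, V₁ 0 ≠ V₁ s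

/-- The projection to the `q`-axis of the Liouville leaf (the connected component of the level
set `p ^ 2 / 2 + V q = e`) that lies above `q`: the potential well of energy `e` around `q`. -/
def well (V : ℝ → ℝ) (e q : ℝ) : Set ℝ := connectedComponentIn {s | V s ≤ e} q

/-- The action `(1 / 2π) ∮ p dq` of the Liouville leaf through `w`; the leaf consists of the two
graphs `p = ± √(2 (e - V q))` over its projection. -/
def action (V : ℝ → ℝ) (w : ℝ × ℝ) : ℝ :=
  (1 / Real.pi) * ∫ s in well V (energy V w) w.1, √(2 * (energy V w - V s))

/-- The closed set of regular energies of the subsystem with potential `V`, when the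
complementary subsystem has potential `V'` and the total energy is `h`: the allowed energies
which are at least `δ` away from the singular values of both subsystems. -/
def regularEnergies (V V' : ℝ → ℝ) (δ h : ℝ) : Set ℝ :=
  Icc (⨅ q, V q) (h - ⨅ q, V' q) \
    ((⋃ s ∈ saddles V, Metric.ball (V s) δ) ∪ ⋃ s ∈ saddles V', Metric.ball (h - V' s) δ)

/-- The branch through `w`: the connected family of leaves with regular energies. -/
def branch (V V' : ℝ → ℝ) (δ h : ℝ) (w : ℝ × ℝ) : Set (ℝ × ℝ) :=
  connectedComponentIn {y | energy V y ∈ regularEnergies V V' δ h} w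

/-- The time of travel to the left of the wall `q = 0` and back, along the leaf of energy `e`
that crosses the wall: twice the integral of `dq / p` from the leftmost point of the leaf. -/
def travelTime (V : ℝ → ℝ) (e : ℝ) : ℝ :=
  2 * ∫ s in (sInf (well V e 0))..0, 1 / √(2 * (e - V s))

/-! ### The two-degrees-of-freedom system -/

/-- Phase space, with points `z = (q₁, p₁, q₂, p₂)`. -/
abbrev Phase : Type := ℝ × ℝ × ℝ × ℝ

def q₁ (z : Phase) : ℝ := z.1
def p₁ (z : Phase) : ℝ := z.2.1
def q₂ (z : Phase) : ℝ := z.2.2.1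
def p₂ (z : Phase) : ℝ := z.2.2.2

/-- The separable Hamiltonian `H_int = H₁ + H₂`. -/
def Hint (V₁ V₂ : ℝ → ℝ) (z : Phase) : ℝ :=
  energy V₁ (q₁ z, p₁ z) + energy V₂ (q₂ z, p₂ z)

/-- The coupling potential as a function on phase space. -/
def lift (Vr : ℝ × ℝ → ℝ) (z : Phase) : ℝ := Vr (q₁ z, q₂ z)

/-- The smooth Hamiltonian `H_int + ε V_r`. -/
def Ham (V₁ V₂ : ℝ → ℝ) (Vr : ℝ × ℝ → ℝ) (ε : ℝ) (z : Phase) : ℝ :=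
  Hint V₁ V₂ z + ε * lift Vr z

/-- The Hamiltonian vector field `(∂H/∂p₁, -∂H/∂q₁, ∂H/∂p₂, -∂H/∂q₂)`. -/
def hamField (H : Phase → ℝ) (z : Phase) : Phase :=
  (fderiv ℝ H z (0, 1, 0, 0), -fderiv ℝ H z (1, 0, 0, 0),
    fderiv ℝ H z (0, 0, 0, 1), -fderiv ℝ H z (0, 0, 1, 0))

/-- `z` solves the autonomous equation `z' = X z` on the time set `s`. -/
def SolvesOn (X : Phase → Phase) (s : Set ℝ) (z : ℝ → Phase) : Prop :=
  ∀ t ∈ s, HasDerivWithinAt z (X (z t)) s t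

/-- `w` solves on `s`, along the solution `z` of the equation with `ε = 0`, the first variational
equation with respect to `ε` of the equation `z' = X z + ε Y z`, namely
`w' = DX(z) w + Y(z)`. -/
def SolvesVariationalOn (X Y : Phase → Phase) (s : Set ℝ) (z w : ℝ → Phase) : Prop :=
  ∀ t ∈ s, HasDerivWithinAt w (fderiv ℝ X (z t) (w t) + Y (z t)) s t

/-- Elastic reflection from the vertical wall. -/
def reflect (z : Phase) : Phase := (q₁ z, -p₁ z, q₂ z, p₂ z)

/-- A trajectory of the impact system with smooth motion `z' = X z` in `q₁ > 0` and elastic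
reflection from the wall `q₁ = 0`, on the time interval `[0, T]`, starting at `a`, with exactly
one impact, at time `ts`, which is transverse. The trajectory is two-valued at the impact:
`zm` is its part on `[0, ts]` and `zp` its part on `[ts, T]`. -/
structure IsImpactTrajectory (X : Phase → Phase) (a : Phase) (ts T : ℝ) (zm zp : ℝ → Phase) :
    Prop where
  impact_pos : 0 < ts
  impact_lt : ts < T
  init : zm 0 = a
  before : SolvesOn X (Icc 0 ts) zm
  inside_before : ∀ t ∈ Ico 0 ts, 0 < q₁ (zm t)
  hit : q₁ (zm ts) = 0
  transverse : p₁ (zm ts) < 0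
  reflection : zp ts = reflect (zm ts)
  after : SolvesOn X (Icc ts T) zp
  inside_after : ∀ t ∈ Ioc ts T, 0 < q₁ (zp t)

/-- The cross-section `p₁ = 0`, `p₁' < 0`. -/
def Section (X : Phase → Phase) : Set Phase := {z | p₁ z = 0 ∧ p₁ (X z) < 0}

/-- `tr` is the first positive time at which an impact trajectory with impact time `ts` and
parts `zm`, `zp` meets the cross-section, and this happens after the impact. -/
structure IsReturnTime (X : Phase → Phase) (ts tr : ℝ) (zm zp : ℝ → Phase) : Prop where
  impact_lt : ts < tr
  mem : zp tr ∈ Section X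
  not_before : ∀ t ∈ Ioc 0 ts, zm t ∉ Section X
  not_after : ∀ t ∈ Ico ts tr, zp t ∉ Section X

/-- The first variation `w` with respect to `ε` along the impact trajectory `(zm, zp)` of
`z' = X z` with impact time `ts`, for the fixed initial point and the perturbation
`z' = X z + ε Y z`: it vanishes at time `0`, solves the first variational equation before and
after the impact, and jumps at the impact by the linearization of
(flow until `q₁ = 0`) followed by reflection. Here `ts + ε τ`, with
`τ = - q₁ (wm ts) / p₁ (zm ts)`, is the impact time to first order. -/
structure IsImpactVariation (X Y : Phase → Phase) (ts T : ℝ) (zm zp wm wp : ℝ → Phase) :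
    Prop where
  init : wm 0 = 0
  before : SolvesVariationalOn X Y (Icc 0 ts) zm wm
  jump : wp ts = reflect (wm ts) +
    (-q₁ (wm ts) / p₁ (zm ts)) • (reflect (X (zm ts)) - X (zp ts))
  after : SolvesVariationalOn X Y (Icc ts T) zp wp

/-- The initial points: points of the (unperturbed) cross-section to the right of the wall, on
the unperturbed energy level `h`, on a leaf in the `(q₁, p₁)`-plane that meets the wall, whose
leaf in the `(q₂, p₂)`-plane has an energy in the regular set and an action at distance at least
`ρ` from the action of the tangent leaf `H₂ = h - V₁ 0` of its branch (if there is one). -/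
def initialPoints (V₁ V₂ : ℝ → ℝ) (h δ ρ : ℝ) : Set Phase :=
  {z | z ∈ Section (hamField (Hint V₁ V₂)) ∧ 0 < q₁ z ∧ Hint V₁ V₂ z = h ∧
    0 ∈ well V₁ (energy V₁ (q₁ z, p₁ z)) (q₁ z) ∧
    energy V₂ (q₂ z, p₂ z) ∈ regularEnergies V₂ V₁ δ h ∧
    ∀ y ∈ branch V₂ V₁ δ h (q₂ z, p₂ z), energy V₂ y = h - V₁ 0 →
      ρ ≤ |action V₂ (q₂ z, p₂ z) - action V₂ y|}

end ImpactSystem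

end

open ImpactSystem

/-! For `ε = 0` the two degrees of freedom decouple, and elastic reflection is time reversal of the
first one. If the smooth orbit `z` starts at a right turning point and meets the wall at time `t₀`,
its continuation after the impact is `splice (2 * t₀) z z`: the first pair of coordinates is run
backwards, the second goes on forwards. The return time is therefore `2 * t₀`, and what remains is
perturbation theory over a bounded time, uniformly in the initial point.

Uniformity rests on two facts. The impact speed is bounded below (`exists_energy_gap`): if the
energy of the first subsystem were barely above `V₁ 0`, the second subsystem would have, on the same
branch, a tangent leaf of nearby energy; the action is Hölder continuous in the energy away from
saddles, so the two actions would differ by less than `ρ`. The turning points are uniformly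
non-degenerate (`exists_slope_bound`): they form a compact set, and a degenerate one would put the
energy at a saddle level. Conservation of energy then gives `p₁ ≤ -g * t` up to the wall and
two-sided bounds on `t₀` (`exists_isBaseOrbit`).

The vector fields are cut off outside a ball around the energy level, so that Grönwall's inequality
holds with global constants. The perturbed orbit before the impact and the one after it are both
continued smoothly through the impact, and both are compared with the unperturbed orbit at the
common time `t₀`. Transversality gives the impact time up to `O(ε²)`; moving along straight lines
during the time between the impacts produces the jump of the variation (`impact_expansion`).

If the perturbed orbit hits first, it has to be compared with the reflected unperturbed orbit
continued backwards, behind the wall. Symmetry of the leaf about its left turning point identifies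
this, in the first degree of freedom, with the smooth orbit advanced by the travel time
(`IsCutoff.travelTime_shift`). -/

open scoped NNReal

namespace ImpactSystem

/-! ### Ordinary differential equations -/

section ODE

variable {E : Type*} [NormedAddCommGroup E] [NormedSpace ℝ E]

/-- A continuous function which is positive at `a` and nonpositive at `b > a` has a first zero. -/
theorem exists_first_zero {f : ℝ → ℝ} {a b : ℝ} (hab : a ≤ b) (hf : ContinuousOn f (Icc a b))
    (ha : 0 < f a) (hb : f b ≤ 0) :
    ∃ c ∈ Ioc a b, f c = 0 ∧ ∀ t ∈ Ico a c, 0 < f t := by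
  set S := Icc a b ∩ f ⁻¹' Iic 0 with hS
  have hcl : IsClosed S := hf.preimage_isClosed_of_isClosed isClosed_Icc isClosed_Iic
  have hne : S.Nonempty := ⟨b, ⟨hab, le_rfl⟩, hb⟩
  have hbd : BddBelow S := ⟨a, fun x hx => hx.1.1⟩
  have hc : sInf S ∈ S := hcl.csInf_mem hne hbd
  set c := sInf S
  have hac : a < c := lt_of_le_of_ne hc.1.1 (fun h => by
    have := hc.2
    rw [← h] at this
    exact absurd ha (not_lt.2 this))
  have hpos : ∀ t ∈ Ico a c, 0 < f t := fun t ht => by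
    by_contra hn
    exact absurd (csInf_le hbd ⟨⟨ht.1, ht.2.le.trans hc.1.2⟩, not_lt.1 hn⟩) (not_le.2 ht.2)
  refine ⟨c, ⟨hac, hc.1.2⟩, le_antisymm hc.2 ?_, hpos⟩
  have hcc : ContinuousWithinAt f (Ico a c) c :=
    (hf c hc.1).mono (fun t ht => ⟨ht.1, ht.2.le.trans hc.1.2⟩)
  have : (𝓝[Ico a c] c).NeBot := by
    rw [← mem_closure_iff_nhdsWithin_neBot, closure_Ico hac.ne]
    exact ⟨hac.le, le_rfl⟩
  exact ge_of_tendsto hcc (eventually_nhdsWithin_of_forall fun t ht => (hpos t ht).le)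

theorem gronwallBound_le {δ K η x : ℝ} (hK : 1 ≤ K) (hη : 0 ≤ η) :
    gronwallBound δ K η x ≤ (δ + η) * Real.exp (K * x) := by
  rw [gronwallBound_of_K_ne_0 (by positivity)]
  have h1 : η / K ≤ η := div_le_self hη hK
  have h2 : 0 ≤ η / K := by positivity
  have h3 := Real.exp_pos (K * x)
  simp only
  nlinarith [mul_le_mul_of_nonneg_right h1 h3.le]

/-- Grönwall's inequality for an approximate solution `v` and a solution `u`. -/
theorem norm_sub_le_of_approx {F : E → E} {K : ℝ≥0} (hK : 1 ≤ K) (hF : LipschitzWith K F)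
    {u v v' : ℝ → E} {a b δ η : ℝ} (hη : 0 ≤ η) (hu : ∀ t, HasDerivAt u (F (u t)) t)
    (hv : ∀ t, HasDerivAt v (v' t) t) (hv' : ∀ t ∈ Ico a b, ‖v' t - F (v t)‖ ≤ η)
    (ha : ‖u a - v a‖ ≤ δ) :
    ∀ t ∈ Icc a b, ‖u t - v t‖ ≤ (δ + η) * Real.exp (K * (t - a)) := by
  intro t ht
  have := dist_le_of_approx_trajectories_ODE (v := fun _ => F) (K := K) (f := u) (g := v)
    (f' := fun t => F (u t)) (g' := v') (εf := 0) (εg := η) (δ := δ) (a := a) (b := b)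
    (fun _ => hF) (fun t _ => (hu t).continuousAt.continuousWithinAt)
    (fun t _ => (hu t).hasDerivWithinAt) (fun t _ => by simp)
    (fun t _ => (hv t).continuousAt.continuousWithinAt)
    (fun t _ => (hv t).hasDerivWithinAt) (fun t h => by rw [dist_eq_norm]; exact hv' t h)
    (by rw [dist_eq_norm]; exact ha) t ht
  rw [dist_eq_norm, zero_add] at this
  exact this.trans (gronwallBound_le (by exact_mod_cast hK) hη)

/-- Truncation of the coordinates of phase space at `±R`. -/
theorem exists_truncation (R : ℝ) (hR : 0 ≤ R) : ∃ c : Phase → Phase, LipschitzWith 1 c ∧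
    (∀ x, ‖x‖ ≤ R → c x = x) ∧ (∀ x, ‖c x‖ ≤ R) ∧ ∀ x, ‖c x‖ ≤ ‖x‖ := by
  set k : ℝ → ℝ := fun x => max (-R) (min R x)
  have hk : LipschitzWith 1 k := (LipschitzWith.id.const_min R).const_max (-R)
  have k1 : ∀ x, |x| ≤ R → k x = x := fun x hx => by
    rw [abs_le] at hx
    simp only [k]
    rw [min_eq_right hx.2, max_eq_right hx.1]
  have k2 : ∀ x, |k x| ≤ R := fun x => by
    rw [abs_le]
    exact ⟨le_max_left _ _, max_le (by linarith) (min_le_left _ _)⟩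
  have k3 : ∀ x, |k x| ≤ |x| := fun x => by
    rw [abs_le]
    refine ⟨?_, max_le ?_ ((min_le_right _ _).trans (le_abs_self x))⟩
    · rcases le_or_gt R x with h | h
      · exact le_trans (by linarith [le_abs_self x, hR]) ((by linarith : -R ≤ R).trans
          ((le_min le_rfl h).trans (le_max_right _ _)))
      · exact (neg_abs_le x).trans ((le_min h.le le_rfl).trans (le_max_right _ _))
    · linarith [abs_nonneg x]
  refine ⟨fun z => (k z.1, k z.2.1, k z.2.2.1, k z.2.2.2), ?_, ?_, ?_, ?_⟩
  · refine LipschitzWith.of_dist_le_mul fun x y => ?_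
    have h := fun a b => hk.dist_le_mul a b
    simp only [NNReal.coe_one, one_mul, Prod.dist_eq] at h ⊢
    exact max_le_max (h _ _) (max_le_max (h _ _) (max_le_max (h _ _) (h _ _)))
  · intro x hx
    simp only [Prod.norm_def, max_le_iff, Real.norm_eq_abs] at hx
    ext <;> simp [k1, hx]
  · intro x
    simp only [Prod.norm_def, max_le_iff, Real.norm_eq_abs]
    exact ⟨k2 _, k2 _, k2 _, k2 _⟩
  · intro x
    simp only [Prod.norm_def, Real.norm_eq_abs]
    exact max_le_max (k3 _) (max_le_max (k3 _) (max_le_max (k3 _) (k3 _)))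

variable [CompleteSpace E]

/-- A field of norm at most `L` cannot leave the ball of radius `L * T` within time `T`, so
Picard–Lindelöf on that ball places no restriction on `T`. -/
theorem exists_solution_of_bounded {f : ℝ → E → E} {K L : ℝ≥0}
    (hL : ∀ t, LipschitzWith K (f t)) (hc : ∀ x, Continuous (f · x))
    (hB : ∀ t x, ‖f t x‖ ≤ L) (T : ℝ≥0) (x₀ : E) :
    ∃ u : ℝ → E, u 0 = x₀ ∧ ∀ t ∈ Ioo (-T : ℝ) T, HasDerivAt u (f t (u t)) t := by
  have hp : IsPicardLindelof f (tmin := -T) (tmax := T) ⟨0, by simp, by simp⟩ x₀ (L * T) 0 L K :=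
    { lipschitzOnWith := fun t _ => (hL t).lipschitzOnWith
      continuousOn := fun x _ => (hc x).continuousOn
      norm_le := fun t _ x _ => hB t x
      mul_max_le := by simp }
  obtain ⟨u, h0, hu⟩ := hp.exists_eq_forall_mem_Icc_hasDerivWithinAt₀
  exact ⟨u, h0, fun t ht => (hu t ⟨ht.1.le, ht.2.le⟩).hasDerivAt (Icc_mem_nhds ht.1 ht.2)⟩

end ODE

/-- A linear differential inequality bounds a curve on both sides of the initial time. -/
theorem norm_le_of_linear_growth {E : Type*} [NormedAddCommGroup E] [NormedSpace ℝ E]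
    {u u' : ℝ → E} {K B T : ℝ} (hK : 1 ≤ K) (hB : 0 ≤ B)
    (hu : ∀ t ∈ Ioo (-T) T, HasDerivAt u (u' t) t)
    (hb : ∀ t ∈ Ioo (-T) T, ‖u' t‖ ≤ K * ‖u t‖ + B) :
    ∀ t ∈ Ioo (-T) T, ‖u t‖ ≤ (‖u 0‖ + B) * Real.exp (K * |t|) := by
  have key : ∀ (v v' : ℝ → E), (∀ t ∈ Ioo (-T) T, HasDerivAt v (v' t) t) →
      (∀ t ∈ Ioo (-T) T, ‖v' t‖ ≤ K * ‖v t‖ + B) → ∀ t ∈ Ico 0 T,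
      ‖v t‖ ≤ (‖v 0‖ + B) * Real.exp (K * t) := by
    intro v v' hv hb t ht
    have hs : ∀ s ∈ Icc 0 t, s ∈ Ioo (-T) T := fun s hs =>
      ⟨by linarith [hs.1, ht.1, ht.2], hs.2.trans_lt ht.2⟩
    have := norm_le_gronwallBound_of_norm_deriv_right_le (f := v) (f' := v') (δ := ‖v 0‖) (K := K)
      (ε := B) (a := 0) (b := t) (fun s h => (hv s (hs s h)).continuousAt.continuousWithinAt)
      (fun s h => (hv s (hs s ⟨h.1, h.2.le⟩)).hasDerivWithinAt) le_rfl
      (fun s h => hb s (hs s ⟨h.1, h.2.le⟩)) t ⟨ht.1, le_rfl⟩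
    rw [sub_zero] at this
    exact this.trans (gronwallBound_le hK hB)
  intro t ht
  rcases le_total 0 t with h | h
  · rw [abs_of_nonneg h]
    exact key u u' hu hb t ⟨h, ht.2⟩
  · rw [abs_of_nonpos h]
    have hneg : ∀ s ∈ Ioo (-T) T, -s ∈ Ioo (-T) T := fun s hs =>
      ⟨by linarith [hs.2], by linarith [hs.1]⟩
    have := key (fun s => u (-s)) (fun s => -u' (-s))
      (fun s hs => by
        have h1 := (hu (-s) (hneg s hs)).scomp s (hasDerivAt_neg s)
        simpa [Function.comp_def] using h1)
      (fun s hs => by simpa using hb (-s) (hneg s hs)) (-t) ⟨by linarith, by linarith [ht.1]⟩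
    simpa using this

/-- Linear growth bounds any solution on `(-n, n)` in advance. Truncating the argument of the field
at that radius makes the field bounded and keeps its Lipschitz constant, and the solution never
notices the truncation. The local solutions are glued by uniqueness. -/
theorem exists_global_solution_zero {f : ℝ → Phase → Phase} {K B : ℝ≥0} (hK : 1 ≤ K)
    (hL : ∀ t, LipschitzWith K (f t)) (hc : ∀ x, Continuous (f · x))
    (hB : ∀ t, ‖f t 0‖ ≤ B) (x₀ : Phase) :
    ∃ u : ℝ → Phase, u 0 = x₀ ∧ ∀ t, HasDerivAt u (f t (u t)) t := by
  have hgrow : ∀ t x, ‖f t x‖ ≤ K * ‖x‖ + B := fun t x => by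
    have h1 := (hL t).norm_sub_le x 0
    rw [sub_zero] at h1
    calc ‖f t x‖ = ‖(f t x - f t 0) + f t 0‖ := by rw [sub_add_cancel]
      _ ≤ _ := (norm_add_le _ _).trans (add_le_add h1 (hB t))
  have hloc : ∀ n : ℕ, ∃ u : ℝ → Phase, u 0 = x₀ ∧
      ∀ t ∈ Ioo (-(n : ℝ)) n, HasDerivAt u (f t (u t)) t := by
    intro n
    set R : ℝ := (‖x₀‖ + B) * Real.exp (K * n) with hR
    have hR0 : 0 ≤ R := by positivity
    obtain ⟨c, c1, c2, c3, c4⟩ := exists_truncation R hR0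
    obtain ⟨u, hu0, hu⟩ := exists_solution_of_bounded (f := fun t x => f t (c x)) (K := K)
      (L := ⟨K * R + B, by positivity⟩) (fun t => by have h := (hL t).comp c1; rw [mul_one] at h; exact h)
      (fun x => hc (c x))
      (fun t x => (hgrow t (c x)).trans (by
        show _ ≤ (K : ℝ) * R + B
        gcongr; exact c3 x)) n x₀
    simp only [NNReal.coe_natCast] at hu
    refine ⟨u, hu0, fun t ht => ?_⟩
    have hb := norm_le_of_linear_growth (K := K) (B := B) (T := n) (by exact_mod_cast hK)
      B.2 hu (fun t _ => (hgrow t (c (u t))).trans (by gcongr; exact c4 _)) t ht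
    have : ‖u t‖ ≤ R := hb.trans (by
      rw [hu0, hR]
      gcongr
      exact abs_le.2 ⟨ht.1.le, ht.2.le⟩)
    have h := hu t ht
    rwa [c2 _ this] at h
  choose u hu0 hu using hloc
  have huniq : ∀ m n : ℕ, m ≤ n → ∀ t ∈ Ioo (-(m : ℝ)) m, u m t = u n t := by
    intro m n hmn t ht
    have hm : (m : ℝ) ≤ n := by exact_mod_cast hmn
    have h0 : (0 : ℝ) ∈ Ioo (-(m : ℝ)) m := by constructor <;> linarith [ht.1, ht.2]
    exact ODE_solution_unique_of_mem_Ioo (v := f) (s := fun _ => univ) (K := K)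
      (fun t _ => (hL t).lipschitzOnWith) h0 (fun s hs => ⟨hu m s hs, trivial⟩)
      (fun s hs => ⟨hu n s ⟨by linarith [hs.1], by linarith [hs.2]⟩, trivial⟩)
      (by rw [hu0, hu0]) ht
  refine ⟨fun t => u (⌊|t|⌋₊ + 1) t, hu0 _, fun t => ?_⟩
  set N := ⌊|t|⌋₊ + 1 with hN
  have hmem : ∀ s : ℝ, s ∈ Ioo (-((⌊|s|⌋₊ + 1 : ℕ) : ℝ)) ((⌊|s|⌋₊ + 1 : ℕ) : ℝ) := fun s => by
    have := Nat.lt_floor_add_one |s|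
    rw [mem_Ioo, ← abs_lt]
    exact_mod_cast this
  have hev : (fun s => u (⌊|s|⌋₊ + 1) s) =ᶠ[𝓝 t] u N := by
    filter_upwards [Ioo_mem_nhds (hmem t).1 (hmem t).2] with s hs
    rcases le_total (⌊|s|⌋₊ + 1) N with h | h
    · exact huniq _ _ h s (hmem s)
    · exact (huniq _ _ h s hs).symm
  exact (hu N t (hmem t)).congr_of_eventuallyEq hev

/-- Global existence for a globally Lipschitz time-dependent vector field on phase space. -/
theorem exists_global_solution {f : ℝ → Phase → Phase} {K B : ℝ≥0} (hK : 1 ≤ K)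
    (hL : ∀ t, LipschitzWith K (f t)) (hc : ∀ x, Continuous (f · x))
    (hB : ∀ t, ‖f t 0‖ ≤ B) (t₀ : ℝ) (x₀ : Phase) :
    ∃ u : ℝ → Phase, u t₀ = x₀ ∧ ∀ t, HasDerivAt u (f t (u t)) t := by
  obtain ⟨u, hu0, hu⟩ := exists_global_solution_zero (f := fun t => f (t + t₀)) hK
    (fun t => hL _) (fun x => (hc x).comp (by fun_prop)) (fun t => hB _) x₀
  refine ⟨fun t => u (t - t₀), by simpa using hu0, fun t => ?_⟩
  have := (hu (t - t₀)).comp_sub_const t t₀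
  simpa using this

/-! ### Perturbation of trajectories -/

section Tame

variable {E : Type*} [NormedAddCommGroup E] [NormedSpace ℝ E]

/-- A vector field that is bounded, Lipschitz, and has a Lipschitz derivative, with one common
constant. -/
structure IsTame (F : E → E) (K : ℝ≥0) : Prop where
  lipschitz : LipschitzWith K F
  bound : ∀ z, ‖F z‖ ≤ K
  differentiable : Differentiable ℝ F
  fderiv_lipschitz : LipschitzWith K (fderiv ℝ F)

theorem IsTame.mono {F : E → E} {K K' : ℝ≥0} (h : IsTame F K) (hK : K ≤ K') : IsTame F K' :=
  ⟨h.lipschitz.weaken hK, fun z => (h.bound z).trans hK, h.differentiable,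
    h.fderiv_lipschitz.weaken hK⟩

theorem exists_isTame {F : E → E} (hF : ContDiff ℝ 2 F) (hs : HasCompactSupport F) :
    ∃ K, IsTame F K := by
  obtain ⟨K₁, h₁⟩ := hF.lipschitzWith_of_hasCompactSupport hs (by simp)
  obtain ⟨K₂, h₂⟩ := (hF.fderiv_right (m := 1) (by norm_num)).lipschitzWith_of_hasCompactSupport
    (hs.fderiv ℝ) (by simp)
  obtain ⟨K₃, h₃⟩ := hs.exists_bound_of_continuous hF.continuous
  refine ⟨max K₁ (max K₂ K₃.toNNReal), h₁.weaken (le_max_left _ _), fun z => ?_,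
    hF.differentiable (by simp), h₂.weaken ((le_max_left _ _).trans (le_max_right _ _))⟩
  calc ‖F z‖ ≤ K₃ := h₃ z
    _ ≤ K₃.toNNReal := Real.le_coe_toNNReal K₃
    _ ≤ _ := by exact_mod_cast (le_max_right _ _).trans (le_max_right _ _)

theorem IsTame.norm_sub_le {F : E → E} {K : ℝ≥0} (h : IsTame F K) (x y : E) :
    ‖F x - F y‖ ≤ K * ‖x - y‖ := h.lipschitz.norm_sub_le x y

theorem IsTame.norm_fderiv_le {F : E → E} {K : ℝ≥0} (h : IsTame F K) (z v : E) :
    ‖fderiv ℝ F z v‖ ≤ K * ‖v‖ :=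
  (fderiv ℝ F z).le_of_opNorm_le (norm_fderiv_le_of_lipschitz ℝ h.lipschitz) v

/-- On the ball of radius `‖v‖` about `z` the derivative varies by at most `K * ‖v‖`; the mean value
inequality gives the rest. The sharp factor `1 / 2` is not needed. -/
theorem IsTame.taylor {F : E → E} {K : ℝ≥0} (h : IsTame F K) (z v : E) :
    ‖F (z + v) - F z - fderiv ℝ F z v‖ ≤ K * ‖v‖ ^ 2 := by
  have key := (convex_closedBall z ‖v‖).norm_image_sub_le_of_norm_hasFDerivWithin_le'
    (f := F) (f' := fderiv ℝ F) (φ := fderiv ℝ F z) (C := K * ‖v‖) (x := z) (y := z + v)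
    (fun x _ => (h.differentiable x).hasFDerivAt.hasFDerivWithinAt)
    (fun x hx => (h.fderiv_lipschitz.norm_sub_le x z).trans (by
      gcongr
      simpa [dist_eq_norm] using hx)) (by simp) (by simp)
  rw [add_sub_cancel_left] at key
  calc _ ≤ _ := key
    _ = _ := by ring

variable {F G : E → E} {K : ℝ≥0} {ε : ℝ} {y z w : ℝ → E}

theorem norm_speed_le (hF : IsTame F K) (hG : IsTame G K) (hε : |ε| ≤ 1) (x : E) :
    ‖F x + ε • G x‖ ≤ 2 * K := by
  have h1 := hF.bound x
  have h2 := hG.bound x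
  calc _ ≤ ‖F x‖ + |ε| * ‖G x‖ := (norm_add_le _ _).trans (by rw [norm_smul, Real.norm_eq_abs])
    _ ≤ K + 1 * K := by gcongr
    _ = _ := by ring

theorem lipschitzWith_add_smul (hF : IsTame F K) (hG : IsTame G K) (hε : |ε| ≤ 1) :
    LipschitzWith (2 * K) (fun x => F x + ε • G x) := by
  refine LipschitzWith.of_dist_le_mul fun x x' => ?_
  rw [dist_eq_norm, dist_eq_norm]
  calc ‖F x + ε • G x - (F x' + ε • G x')‖ = ‖(F x - F x') + ε • (G x - G x')‖ := by
        congr 1; rw [smul_sub]; abel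
    _ ≤ ‖F x - F x'‖ + |ε| * ‖G x - G x'‖ :=
        (norm_add_le _ _).trans (by rw [norm_smul, Real.norm_eq_abs])
    _ ≤ K * ‖x - x'‖ + 1 * (K * ‖x - x'‖) := by
        gcongr
        · exact hF.norm_sub_le _ _
        · exact hG.norm_sub_le _ _
    _ = _ := by push_cast; ring

theorem norm_sub_le_of_speed (hF : IsTame F K) (hG : IsTame G K) (hε : |ε| ≤ 1)
    (hy : ∀ t, HasDerivAt y (F (y t) + ε • G (y t)) t) (s t : ℝ) :
    ‖y t - y s‖ ≤ 2 * K * |t - s| :=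
  convex_univ.norm_image_sub_le_of_norm_hasDerivWithin_le
    (fun x _ => (hy x).hasDerivWithinAt) (fun x _ => norm_speed_le hF hG hε (y x))
    (mem_univ s) (mem_univ t)

/-- Continuous dependence on `ε` to first order. -/
theorem first_order_bound (hK : 1 ≤ K) (hF : IsTame F K) (hG : IsTame G K)
    (hy : ∀ t, HasDerivAt y (F (y t) + ε • G (y t)) t) (hz : ∀ t, HasDerivAt z (F (z t)) t)
    {a b T D : ℝ} (hT : b - a ≤ T) (hD : 0 ≤ D) (ha : ‖y a - z a‖ ≤ D * |ε|) :
    ∀ t ∈ Icc a b, ‖y t - z t‖ ≤ (D + K) * Real.exp (K * T) * |ε| := by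
  intro t ht
  have := norm_sub_le_of_approx hK hF.lipschitz (u := z) (v := y) (a := a) (b := b)
    (η := K * |ε|) (δ := D * |ε|) (by positivity) hz hy (fun t _ => by
      rw [add_sub_cancel_left, norm_smul, Real.norm_eq_abs, mul_comm]
      exact mul_le_mul_of_nonneg_right (hG.bound _) (abs_nonneg _))
    (by rw [norm_sub_rev]; exact ha) t ht
  rw [norm_sub_rev]
  calc _ ≤ _ := this
    _ ≤ (D * |ε| + K * |ε|) * Real.exp (K * T) := by gcongr; linarith [ht.2]
    _ = _ := by ring

theorem variation_bound (hK : 1 ≤ K) (hF : IsTame F K) (hG : IsTame G K)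
    (hw : ∀ t, HasDerivAt w (fderiv ℝ F (z t) (w t) + G (z t)) t)
    {a b T D : ℝ} (hT : b - a ≤ T) (hD : 0 ≤ D) (ha : ‖w a‖ ≤ D) :
    ∀ t ∈ Icc a b, ‖w t‖ ≤ (D + K) * Real.exp (K * T) := by
  intro t ht
  have := norm_le_gronwallBound_of_norm_deriv_right_le (f := w) (δ := D) (K := K)
    (ε := K) (a := a) (b := b) (fun s _ => (hw s).continuousAt.continuousWithinAt)
    (fun s _ => (hw s).hasDerivWithinAt) ha
    (fun s _ => (norm_add_le _ _).trans (add_le_add (hF.norm_fderiv_le _ _) (hG.bound _))) t ht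
  refine (this.trans (gronwallBound_le (by exact_mod_cast hK) K.2)).trans ?_
  gcongr
  linarith [ht.2]

/-- Expansion of a trajectory in `ε` to second order. -/
theorem second_order_bound (hK : 1 ≤ K) (hF : IsTame F K) (hG : IsTame G K) (hε : |ε| ≤ 1)
    (hy : ∀ t, HasDerivAt y (F (y t) + ε • G (y t)) t) (hz : ∀ t, HasDerivAt z (F (z t)) t)
    (hw : ∀ t, HasDerivAt w (fderiv ℝ F (z t) (w t) + G (z t)) t)
    {a b T D W : ℝ} (hT : b - a ≤ T) (hD : 0 ≤ D) (hW : ∀ t ∈ Icc a b, ‖w t‖ ≤ W)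
    (ha : ‖y a - (z a + ε • w a)‖ ≤ D * ε ^ 2) :
    ∀ t ∈ Icc a b, ‖y t - (z t + ε • w t)‖ ≤
      (D + (K * W ^ 2 + K * W)) * Real.exp (2 * K * T) * ε ^ 2 := by
  intro t ht
  have hW0 : 0 ≤ W := (norm_nonneg _).trans (hW t ht)
  have hL := lipschitzWith_add_smul hF hG hε
  have hsq : |ε| * |ε| = ε ^ 2 := by rw [← sq, sq_abs]
  -- The curve `z + ε • w` nearly solves the perturbed equation: its defect is the Taylor remainder
  -- of `F`, at most `K * W ^ 2 * ε ^ 2`, plus the variation of `ε • G`, at most `K * W * ε ^ 2`.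
  have := norm_sub_le_of_approx (K := 2 * K) (by
      calc (1 : ℝ≥0) ≤ K := hK
        _ ≤ 2 * K := by rw [two_mul]; exact le_add_self) hL (u := y)
    (v := fun t => z t + ε • w t) (a := a) (b := b)
    (η := (K * W ^ 2 + K * W) * ε ^ 2) (δ := D * ε ^ 2) (by positivity) hy
    (fun t => (hz t).add ((hw t).const_smul ε)) (fun t ht => by
      have hwt := hW t ⟨ht.1, ht.2.le⟩
      have h1 := hF.taylor (z t) (ε • w t)
      have h2 := hG.norm_sub_le (z t + ε • w t) (z t)
      rw [add_sub_cancel_left] at h2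
      rw [norm_smul, Real.norm_eq_abs] at h1 h2
      rw [map_smul] at h1
      calc _ = ‖(F (z t + ε • w t) - F (z t) - ε • fderiv ℝ F (z t) (w t))
            + ε • (G (z t + ε • w t) - G (z t))‖ := by
            rw [← norm_neg]; congr 1; rw [smul_sub, smul_add]; abel
        _ ≤ K * (|ε| * ‖w t‖) ^ 2 + |ε| * (K * (|ε| * ‖w t‖)) := by
            refine (norm_add_le _ _).trans (add_le_add h1 ?_)
            rw [norm_smul, Real.norm_eq_abs]
            gcongr
        _ ≤ K * (|ε| * W) ^ 2 + |ε| * (K * (|ε| * W)) := by gcongr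
        _ = _ := by rw [mul_pow, sq_abs, ← hsq]; ring) ha t ht
  calc _ ≤ _ := this
    _ ≤ (D * ε ^ 2 + (K * W ^ 2 + K * W) * ε ^ 2) * Real.exp (2 * K * T) := by
        push_cast
        gcongr
        linarith [ht.2]
    _ = _ := by ring

/-- Over a time `O(ε)` a trajectory moves along a straight line up to `O(ε²)`. -/
theorem short_time_bound (hF : IsTame F K) (hG : IsTame G K) (hε : |ε| ≤ 1)
    (hy : ∀ t, HasDerivAt y (F (y t) + ε • G (y t)) t) {t₀ t₁ D D' : ℝ} {v : E} (hD : 0 ≤ D)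
    (hv : ‖y t₀ - v‖ ≤ D' * |ε|) (ht : |t₁ - t₀| ≤ D * |ε|) :
    ‖y t₁ - y t₀ - (t₁ - t₀) • F v‖ ≤ K * (2 * K * D + D' + 1) * D * ε ^ 2 := by
  have hsq : |ε| * |ε| = ε ^ 2 := by rw [← sq, sq_abs]
  -- The derivative of `y t - t • F v` is `O(ε)` on an interval of length `O(ε)`.
  have key := (convex_uIcc t₀ t₁).norm_image_sub_le_of_norm_hasDerivWithin_le
    (f := fun t => y t - t • F v) (f' := fun t => (F (y t) + ε • G (y t)) - (1 : ℝ) • F v)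
    (C := K * (2 * K * D + D' + 1) * |ε|) (x := t₀) (y := t₁)
    (fun s _ => ((hy s).sub ((hasDerivAt_id s).smul_const (F v))).hasDerivWithinAt)
    (fun s hs => by
      have h1 := norm_sub_le_of_speed hF hG hε hy t₀ s
      have h2 : |s - t₀| ≤ D * |ε| := (abs_sub_left_of_mem_uIcc hs).trans ht
      have h3 : ‖y s - v‖ ≤ 2 * K * (D * |ε|) + D' * |ε| :=
        calc ‖y s - v‖ = ‖(y s - y t₀) + (y t₀ - v)‖ := by congr 1; abel
          _ ≤ 2 * K * |s - t₀| + D' * |ε| := (norm_add_le _ _).trans (add_le_add h1 hv)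
          _ ≤ _ := by gcongr
      calc _ = ‖(F (y s) - F v) + ε • G (y s)‖ := by congr 1; rw [one_smul]; abel
        _ ≤ K * (2 * K * (D * |ε|) + D' * |ε|) + |ε| * K := by
            refine (norm_add_le _ _).trans (add_le_add ((hF.norm_sub_le _ _).trans ?_) ?_)
            · gcongr
            · rw [norm_smul, Real.norm_eq_abs]
              gcongr
              exact hG.bound _
        _ = _ := by ring) left_mem_uIcc right_mem_uIcc
  have hD' : 0 ≤ D' * |ε| := (norm_nonneg _).trans hv
  calc _ = ‖(y t₁ - t₁ • F v) - (y t₀ - t₀ • F v)‖ := by congr 1; rw [sub_smul]; abel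
    _ ≤ _ := key
    _ ≤ K * (2 * K * D + D' + 1) * |ε| * (D * |ε|) := by
        have : 0 ≤ K * (2 * K * D + D' + 1) * |ε| := by
          have : K * (2 * K * D + D' + 1) * |ε| = K * (2 * K * D * |ε| + D' * |ε| + |ε|) := by ring
          rw [this]
          positivity
        gcongr
        exact ht
    _ = _ := by rw [← hsq]; ring

end Tame

/-! ### The impact -/

theorem norm_reflect (z : Phase) : ‖reflect z‖ = ‖z‖ := by
  simp [reflect, Prod.norm_def, q₁, p₁, q₂, p₂]

theorem reflect_sub (z z' : Phase) : reflect (z - z') = reflect z - reflect z' := by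
  ext <;> simp [reflect, q₁, p₁, q₂, p₂]
  ring

theorem reflect_smul (c : ℝ) (z : Phase) : reflect (c • z) = c • reflect z := by
  ext <;> simp [reflect, q₁, p₁, q₂, p₂]

theorem abs_q₁_le (z : Phase) : |q₁ z| ≤ ‖z‖ := by
  simp [Prod.norm_def, q₁]

theorem abs_p₁_le (z : Phase) : |p₁ z| ≤ ‖z‖ := by
  simp [Prod.norm_def, p₁]

/-- The expansion of a trajectory after an impact: the jump of the first variation. -/
theorem impact_expansion {F G : Phase → Phase} {K : ℝ≥0} {ε : ℝ} {zm zp wm wp ym yp : ℝ → Phase}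
    (hF : IsTame F K) (hG : IsTame G K) (hε : |ε| ≤ 1)
    (hym : ∀ t, HasDerivAt ym (F (ym t) + ε • G (ym t)) t)
    (hyp : ∀ t, HasDerivAt yp (F (yp t) + ε • G (yp t)) t)
    {t₀ t₁ D m : ℝ} (hD : 0 ≤ D) (hm : 0 < m)
    (h1 : ‖ym t₀ - zm t₀‖ ≤ D * |ε|) (h2 : ‖ym t₀ - (zm t₀ + ε • wm t₀)‖ ≤ D * ε ^ 2)
    (ht : |t₁ - t₀| ≤ D * |ε|) (hzp : zp t₀ = reflect (zm t₀)) (hyp₁ : yp t₁ = reflect (ym t₁))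
    (hqz : q₁ (zm t₀) = 0) (hqy : q₁ (ym t₁) = 0) (hF₁ : q₁ (F (zm t₀)) = p₁ (zm t₀))
    (hp : m ≤ |p₁ (zm t₀)|)
    (hwp : wp t₀ = reflect (wm t₀) +
      (-q₁ (wm t₀) / p₁ (zm t₀)) • (reflect (F (zm t₀)) - F (zp t₀))) :
    ‖yp t₀ - zp t₀‖ ≤ (4 * K * D + D) * |ε| ∧
    ‖yp t₀ - (zp t₀ + ε • wp t₀)‖ ≤
      (K * (2 * K * D + (4 * K * D + D) + 1) * D + K * (2 * K * D + D + 1) * D + D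
        + (K * (2 * K * D + D + 1) * D + D) / m * (2 * K)) * ε ^ 2 := by
  have hy1 : ‖ym t₁ - zm t₀‖ ≤ (2 * K * D + D) * |ε| := by
    calc ‖ym t₁ - zm t₀‖ = ‖(ym t₁ - ym t₀) + (ym t₀ - zm t₀)‖ := by congr 1; abel
      _ ≤ 2 * K * |t₁ - t₀| + D * |ε| :=
          (norm_add_le _ _).trans (add_le_add (norm_sub_le_of_speed hF hG hε hym _ _) h1)
      _ ≤ 2 * K * (D * |ε|) + D * |ε| := by gcongr
      _ = _ := by ring
  have hfirst : ‖yp t₀ - zp t₀‖ ≤ (4 * K * D + D) * |ε| := by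
    calc ‖yp t₀ - zp t₀‖ = ‖(yp t₀ - yp t₁) + reflect (ym t₁ - zm t₀)‖ := by
          rw [reflect_sub, ← hzp, ← hyp₁]; congr 1; abel
      _ ≤ 2 * K * |t₀ - t₁| + (2 * K * D + D) * |ε| := by
          refine (norm_add_le _ _).trans (add_le_add (norm_sub_le_of_speed hF hG hε hyp _ _) ?_)
          rw [norm_reflect]; exact hy1
      _ ≤ 2 * K * (D * |ε|) + (2 * K * D + D) * |ε| := by rw [abs_sub_comm]; gcongr
      _ = _ := by ring
  refine ⟨hfirst, ?_⟩
  have e1 := short_time_bound hF hG hε hym hD h1 ht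
  have e2 := short_time_bound hF hG hε hyp hD hfirst ht
  set τ := -q₁ (wm t₀) / p₁ (zm t₀) with hτ
  have hp0 : p₁ (zm t₀) ≠ 0 := fun h => by rw [h, abs_zero] at hp; linarith
  -- The `q₁` coordinate vanishes at `zm t₀` and at `ym t₁`. Along the straight-line approximation
  -- this is a linear equation for `t₁ - t₀` with slope `p₁ (zm t₀)`, which is at least `m` in
  -- absolute value.
  have hτb : |(t₁ - t₀) - ε * τ| ≤ (K * (2 * K * D + D + 1) * D + D) / m * ε ^ 2 := by
    have hlin : q₁ (ym t₁ - ym t₀ - (t₁ - t₀) • F (zm t₀)) + q₁ (ym t₀ - (zm t₀ + ε • wm t₀))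
        = -((t₁ - t₀) - ε * τ) * p₁ (zm t₀) := by
      have : q₁ (ym t₁ - ym t₀ - (t₁ - t₀) • F (zm t₀)) + q₁ (ym t₀ - (zm t₀ + ε • wm t₀)) =
          q₁ (ym t₁) - (t₁ - t₀) * q₁ (F (zm t₀)) - q₁ (zm t₀) - ε * q₁ (wm t₀) := by
        simp [q₁]; ring
      rw [this, hqy, hqz, hF₁, hτ]
      field_simp
      ring
    have hb : |(t₁ - t₀) - ε * τ| * |p₁ (zm t₀)| ≤
        (K * (2 * K * D + D + 1) * D + D) * ε ^ 2 := by
      calc _ = |q₁ (ym t₁ - ym t₀ - (t₁ - t₀) • F (zm t₀)) +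
            q₁ (ym t₀ - (zm t₀ + ε • wm t₀))| := by rw [hlin, abs_mul, abs_neg]
        _ ≤ K * (2 * K * D + D + 1) * D * ε ^ 2 + D * ε ^ 2 :=
            (abs_add_le _ _).trans (add_le_add ((abs_q₁_le _).trans e1) ((abs_q₁_le _).trans h2))
        _ = _ := by ring
    rw [div_mul_eq_mul_div, le_div_iff₀ hm]
    exact (mul_le_mul_of_nonneg_left hp (abs_nonneg _)).trans hb
  -- Go from `ym t₀` forward to `t₁`, reflect, and go back along `yp` to `t₀`. The first two terms
  -- are straight-line errors, the third is the error before the impact, and the last replaces `t₁ -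
  -- t₀` by `ε * τ`.
  have hdecomp : yp t₀ - (zp t₀ + ε • wp t₀) =
      -(yp t₁ - yp t₀ - (t₁ - t₀) • F (zp t₀))
      + reflect (ym t₁ - ym t₀ - (t₁ - t₀) • F (zm t₀))
      + reflect (ym t₀ - (zm t₀ + ε • wm t₀))
      + ((t₁ - t₀) - ε * τ) • (reflect (F (zm t₀)) - F (zp t₀)) := by
    have hadd : reflect (zm t₀ + ε • wm t₀) = reflect (zm t₀) + ε • reflect (wm t₀) := by
      rw [← sub_neg_eq_add, reflect_sub, ← neg_smul, reflect_smul, neg_smul, sub_neg_eq_add]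
    rw [reflect_sub, reflect_sub, reflect_sub, reflect_smul, hadd, ← hzp, ← hyp₁, hwp]
    module
  have hjump : ‖reflect (F (zm t₀)) - F (zp t₀)‖ ≤ 2 * K := by
    refine (norm_sub_le _ _).trans ?_
    rw [norm_reflect]
    linarith [hF.bound (zm t₀), hF.bound (zp t₀)]
  rw [hdecomp]
  have n1 : ‖-(yp t₁ - yp t₀ - (t₁ - t₀) • F (zp t₀))‖ ≤
      K * (2 * K * D + (4 * K * D + D) + 1) * D * ε ^ 2 := by rw [norm_neg]; exact e2
  have n2 := (norm_reflect (ym t₁ - ym t₀ - (t₁ - t₀) • F (zm t₀))).le.trans e1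
  have n3 := (norm_reflect (ym t₀ - (zm t₀ + ε • wm t₀))).le.trans h2
  have n4 : ‖((t₁ - t₀) - ε * τ) • (reflect (F (zm t₀)) - F (zp t₀))‖ ≤
      (K * (2 * K * D + D + 1) * D + D) / m * ε ^ 2 * (2 * K) := by
    rw [norm_smul, Real.norm_eq_abs]
    have : 0 ≤ (K * (2 * K * D + D + 1) * D + D) / m * ε ^ 2 := by positivity
    gcongr
  calc _ ≤ _ := (norm_add_le _ _).trans (add_le_add ((norm_add_le _ _).trans
        (add_le_add ((norm_add_le _ _).trans (add_le_add n1 n2)) n3)) n4)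
    _ = _ := by ring

/-! ### Potential wells -/

/-- The second-order necessary condition at a one-sided local maximum. -/
theorem deriv_deriv_nonpos_of_left_max {V : ℝ → ℝ} (hV : ContDiff ℝ 2 V) {a x : ℝ} (hax : a < x)
    (hx : deriv V x = 0) (hmax : ∀ y ∈ Ioo a x, V y ≤ V x) : deriv (deriv V) x ≤ 0 := by
  by_contra hpos
  rw [not_le] at hpos
  have hd : Differentiable ℝ (deriv V) :=
    (ContDiff.deriv' (n := 1) (by rwa [one_add_one_eq_two])).differentiable (by simp)
  have hs := hasDerivAt_iff_tendsto_slope.1 (hd x).hasDerivAt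
  have hev : ∀ᶠ y in 𝓝[<] x, deriv V y < 0 := by
    have h1 : ∀ᶠ y in 𝓝[<] x, 0 < slope (deriv V) x y :=
      (hs.mono_left (nhdsWithin_mono x fun y hy => ne_of_lt hy)).eventually (lt_mem_nhds hpos)
    filter_upwards [h1, self_mem_nhdsWithin] with y hy hyx
    rw [slope_def_field, hx, sub_zero] at hy
    have hyx' : y - x < 0 := sub_neg.2 hyx
    by_contra hn
    exact absurd hy (not_lt.2 (div_nonpos_of_nonneg_of_nonpos (not_lt.1 hn) hyx'.le))
  obtain ⟨b, hb, hbs⟩ := (mem_nhdsLT_iff_exists_Ioo_subset' hax).1 hev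
  set m := max a b
  have hm : m < x := max_lt hax hb
  have hanti : StrictAntiOn V (Icc ((m + x) / 2) x) := by
    refine strictAntiOn_of_deriv_neg (convex_Icc _ _) hV.continuous.continuousOn fun y hy => ?_
    rw [interior_Icc] at hy
    exact hbs ⟨by linarith [hy.1, le_max_right a b], hy.2⟩
  have := hanti (left_mem_Icc.2 (by linarith)) (right_mem_Icc.2 (by linarith))
    (by linarith : (m + x) / 2 < x)
  exact absurd (hmax ((m + x) / 2) ⟨by linarith [le_max_left a b], by linarith⟩) (not_le.2 this)

/-- The right turning points in `[0, R]` of leaves that cross `q = 0` at a depth at least `c` below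
their energy, with energies at distance at least `δ` from the saddles. -/
def turningPoints (V : ℝ → ℝ) (δ c R : ℝ) : Set ℝ :=
  {x | x ∈ Icc 0 R ∧ V 0 + c ≤ V x ∧ (∀ s ∈ saddles V, δ ≤ |V x - V s|) ∧
    ∀ θ ∈ Icc (0 : ℝ) 1, V (θ * x) ≤ V x}

/-- All conditions are non-strict inequalities between continuous functions of `x`. The factor `θ`
gives the last family an index set that does not depend on `x`. -/
theorem isCompact_turningPoints {V : ℝ → ℝ} (hV : Continuous V) (δ c R : ℝ) :
    IsCompact (turningPoints V δ c R) := by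
  have : turningPoints V δ c R = Icc 0 R ∩ ({x | V 0 + c ≤ V x} ∩
      ((⋂ s ∈ saddles V, {x | δ ≤ |V x - V s|}) ∩ ⋂ θ ∈ Icc (0 : ℝ) 1, {x | V (θ * x) ≤ V x})) := by
    ext x
    simp [turningPoints]
  rw [this]
  refine isCompact_Icc.inter_right ((isClosed_le (by fun_prop) hV).inter (IsClosed.inter ?_ ?_))
  · exact isClosed_biInter fun s _ => isClosed_le (by fun_prop) (by fun_prop)
  · exact isClosed_biInter fun s _ => isClosed_le (by fun_prop) (by fun_prop)

/-- A critical one-sided maximum has nonpositive second derivative, hence by non-degeneracy a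
negative one, and is a saddle. With `e = V x` the conclusion reads `δ ≤ 0`, which rules such points
out. -/
theorem not_critical_of_left_max {V : ℝ → ℝ} (hV : ContDiff ℝ 2 V)
    (hnd : ∀ q, deriv V q = 0 → deriv (deriv V) q ≠ 0) {δ e : ℝ}
    (hs : ∀ s ∈ saddles V, δ ≤ |e - V s|) {a x : ℝ} (hax : a < x)
    (hmax : ∀ y ∈ Ioo a x, V y ≤ V x) (hx : deriv V x = 0) : δ ≤ |e - V x| :=
  hs x ⟨hx, lt_of_le_of_ne (deriv_deriv_nonpos_of_left_max hV hax hx hmax) (hnd x hx)⟩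

/-- Uniform non-degeneracy of the turning points. -/
theorem exists_slope_bound {V : ℝ → ℝ} (hV : ContDiff ℝ 2 V)
    (hnd : ∀ q, deriv V q = 0 → deriv (deriv V) q ≠ 0) {δ c : ℝ} (hδ : 0 < δ) (hc : 0 < c)
    (R : ℝ) :
    ∃ g > 0, ∀ x ∈ turningPoints V δ c R, ∀ y ∈ Icc 0 x, g * (x - y) ≤ V x - V y := by
  -- The difference quotient of `V` between `θ * x` and `x`, written as a mean of the derivative so
  -- that it extends continuously to `θ = 1`. Its minimum over a compact set is the constant `g`.
  set Φ : ℝ × ℝ → ℝ := fun P => ∫ s in (0 : ℝ)..1, deriv V (P.2 * P.1 + s • (P.1 - P.2 * P.1))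
    with hΦ
  have hcd : Continuous (deriv V) := hV.continuous_deriv (by simp)
  have hΦc : Continuous Φ := by
    refine intervalIntegral.continuous_parametric_intervalIntegral_of_continuous' ?_ 0 1
    simp only [Function.uncurry_def]
    fun_prop
  have hΦe : ∀ x θ, (x - θ * x) * Φ (x, θ) = V x - V (θ * x) := fun x θ => by
    have := intervalIntegral.integral_unitInterval_deriv_eq_sub (𝕜 := ℝ) (f := V) (f' := deriv V)
      (z₀ := θ * x) (z₁ := x - θ * x) (by fun_prop)
      (fun t _ => (hV.differentiable (by simp) _).hasDerivAt)
    rw [add_sub_cancel] at this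
    rw [← this, smul_eq_mul]
  have hxpos : ∀ x ∈ turningPoints V δ c R, 0 < x := fun x hx =>
    lt_of_le_of_ne hx.1.1 fun h => by
      have := hx.2.1
      rw [← h] at this
      linarith
  have hle : ∀ x ∈ turningPoints V δ c R, ∀ y ∈ Icc 0 x, V y ≤ V x := fun x hx y hy => by
    have h0 := hxpos x hx
    have := hx.2.2.2 (y / x) ⟨div_nonneg hy.1 h0.le, (div_le_one h0).2 hy.2⟩
    rwa [div_mul_cancel₀ _ h0.ne'] at this
  -- A zero at `θ = 1` would make `x` a critical left maximum. A zero at `θ < 1` would give an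
  -- interior local maximum at the level `V x`; the point `0` itself is excluded by the depth `c`.
  -- Both would put a saddle at the energy `V x`.
  have hΦpos : ∀ P ∈ turningPoints V δ c R ×ˢ Icc (0 : ℝ) 1, 0 < Φ P := by
    rintro ⟨x, θ⟩ ⟨hx, hθ⟩
    simp only at hx hθ
    have h0 := hxpos x hx
    rcases eq_or_lt_of_le hθ.2 with h1 | h1
    · have hΦx : Φ (x, θ) = deriv V x := by simp [hΦ, h1]
      rw [hΦx]
      refine lt_of_le_of_ne ?_ fun h => ?_
      · by_contra hneg
        rw [not_le] at hneg
        have hs := hasDerivAt_iff_tendsto_slope.1 ((hV.differentiable (by simp)) x).hasDerivAt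
        have h1 : ∀ᶠ y in 𝓝[<] x, slope V x y < 0 :=
          (hs.mono_left (nhdsWithin_mono x fun y hy => ne_of_lt hy)).eventually (gt_mem_nhds hneg)
        obtain ⟨y, hy, hy'⟩ := (h1.and (Ioo_mem_nhdsLT h0)).exists
        rw [slope_def_field] at hy
        exact absurd hy (not_lt.2 (div_nonneg_of_nonpos
          (sub_nonpos.2 (hle x hx y ⟨hy'.1.le, hy'.2.le⟩)) (sub_nonpos.2 hy'.2.le)))
      · have := not_critical_of_left_max hV hnd hx.2.2.1 h0
          (fun y hy => hle x hx y ⟨hy.1.le, hy.2.le⟩) h.symm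
        simp at this
        linarith
    · have hlt : θ * x < x := by nlinarith
      have hpos : 0 < V x - V (θ * x) := by
        refine lt_of_le_of_ne (sub_nonneg.2 (hx.2.2.2 θ hθ)) fun h => ?_
        have heq : V (θ * x) = V x := by linarith
        have hy0 : 0 < θ * x := by
          refine lt_of_le_of_ne (mul_nonneg hθ.1 h0.le) fun h' => ?_
          have := hx.2.1
          rw [← h'] at heq
          linarith
        have hloc : IsLocalMax V (θ * x) := by
          filter_upwards [Ioo_mem_nhds hy0 hlt] with y hy
          rw [heq]
          exact hle x hx y ⟨hy.1.le, hy.2.le⟩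
        have := not_critical_of_left_max hV hnd hx.2.2.1 hy0
          (fun y hy => heq ▸ hle x hx y ⟨hy.1.le, hy.2.le.trans hlt.le⟩) hloc.deriv_eq_zero
        rw [heq] at this
        simp at this
        linarith
      rw [← hΦe] at hpos
      exact (pos_iff_pos_of_mul_pos hpos).1 (by linarith)
  have hcomp : IsCompact (turningPoints V δ c R ×ˢ Icc (0 : ℝ) 1) :=
    (isCompact_turningPoints hV.continuous δ c R).prod isCompact_Icc
  have hconv : ∀ g : ℝ, (∀ P ∈ turningPoints V δ c R ×ˢ Icc (0 : ℝ) 1, g ≤ Φ P) →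
      ∀ x ∈ turningPoints V δ c R, ∀ y ∈ Icc 0 x, g * (x - y) ≤ V x - V y := by
    intro g hg x hx y hy
    have h0 := hxpos x hx
    have h1 := hg (x, y / x) ⟨hx, div_nonneg hy.1 h0.le, (div_le_one h0).2 hy.2⟩
    have h2 := hΦe x (y / x)
    rw [div_mul_cancel₀ _ h0.ne'] at h2
    rw [← h2, mul_comm]
    exact mul_le_mul_of_nonneg_left h1 (by linarith [hy.2])
  rcases (turningPoints V δ c R ×ˢ Icc (0 : ℝ) 1).eq_empty_or_nonempty with h | h
  · exact ⟨1, one_pos, hconv 1 (by simp [h])⟩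
  · obtain ⟨P, hP, hmin⟩ := hcomp.exists_isMinOn h hΦc.continuousOn
    exact ⟨Φ P, hΦpos P hP, hconv _ fun Q hQ => hmin hQ⟩

/-! ### Wells, actions, branches and the energy gap at the wall. -/

theorem isCompact_sublevel {V : ℝ → ℝ} (hV : Continuous V)
    (hco : Tendsto V (cocompact ℝ) atTop) (e : ℝ) : IsCompact {s | V s ≤ e} := by
  obtain ⟨K, hK, hKs⟩ := mem_cocompact.1 (hco.eventually (eventually_gt_atTop e))
  refine hK.of_isClosed_subset (isClosed_le hV continuous_const) fun s hs => ?_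
  by_contra h
  have h1 : V s ≤ e := hs
  exact absurd h1 (not_le.2 (hKs h))

theorem uIcc_subset_well {V : ℝ → ℝ} {e q x y : ℝ} (hx : x ∈ well V e q) (hy : y ∈ well V e q) :
    uIcc x y ⊆ well V e q :=
  isPreconnected_connectedComponentIn.ordConnected.uIcc_subset hx hy

theorem well_subset {V : ℝ → ℝ} {e q : ℝ} : well V e q ⊆ {s | V s ≤ e} :=
  connectedComponentIn_subset _ _

/-- Negative arguments, where the root is `0`, are included: in the comparison of actions `e - V` is
negative on the part of the larger well outside the smaller one. -/
theorem abs_sqrt_sub_sqrt_le {a b η : ℝ} (h : b - a = η) (hη : 0 ≤ η) :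
    |√a - √b| ≤ √η := by
  have h1 : √a ≤ √b := Real.sqrt_le_sqrt (by linarith)
  rw [abs_sub_comm, abs_of_nonneg (sub_nonneg.2 h1)]
  rcases le_total 0 a with ha | ha
  · have : √b ≤ √a + √η := by
      rw [Real.sqrt_le_left (by positivity)]
      nlinarith [Real.sq_sqrt ha, Real.sq_sqrt hη,
        mul_nonneg (Real.sqrt_nonneg a) (Real.sqrt_nonneg η)]
    linarith
  · have h2 : √b ≤ √η := Real.sqrt_le_sqrt (by linarith)
    rw [Real.sqrt_eq_zero_of_nonpos ha]
    linarith

/-- Hölder continuity of the action in the energy, away from the saddles. -/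
theorem abs_action_sub_le {V : ℝ → ℝ} (hV : ContDiff ℝ 2 V)
    (hnd : ∀ q, deriv V q = 0 → deriv (deriv V) q ≠ 0) (hco : Tendsto V (cocompact ℝ) atTop)
    {w y : ℝ × ℝ} {δ η : ℝ} (hwy : w.1 = y.1) (he : energy V y = energy V w + η) (hη : 0 ≤ η)
    (hηδ : η < δ) (hs : ∀ s ∈ saddles V, δ ≤ |energy V w - V s|) :
    |action V w - action V y| ≤
      1 / Real.pi * (√(2 * η) * MeasureTheory.volume.real {s | V s ≤ energy V y}) := by
  set e := energy V w with he'
  set e' := energy V y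
  set q := w.1 with hq
  have hVc := hV.continuous
  have hqe : V q ≤ e := by
    rw [he']; unfold energy; rw [← hq]; nlinarith [sq_nonneg w.2]
  have hq1 : q ∈ well V e q := mem_connectedComponentIn hqe
  have hsub : well V e q ⊆ well V e' q :=
    connectedComponentIn_mono q fun s (hs : V s ≤ e) => show V s ≤ e' by linarith
  have hmeas : MeasurableSet (well V e' q) :=
    isPreconnected_connectedComponentIn.ordConnected.measurableSet
  have hcomp := isCompact_sublevel hVc hco e'
  -- Raising the energy by less than `δ` merges no wells: the top `m` of a barrier between two of
  -- them would be a saddle with `e < V m ≤ e' < e + δ`.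
  have hout : ∀ x ∈ well V e' q \ well V e q, e < V x := by
    rintro x ⟨hx, hx'⟩
    by_contra hle
    rw [not_lt] at hle
    obtain ⟨m, hm, hmax⟩ := isCompact_uIcc.exists_isMaxOn (nonempty_uIcc (a := q) (b := x))
      hVc.continuousOn
    have hme : e < V m := by
      by_contra hn
      rw [not_lt] at hn
      exact hx' (isPreconnected_uIcc.subset_connectedComponentIn left_mem_uIcc
        (fun s hs => (hmax hs).trans hn) right_mem_uIcc)
    have hm' : m ∈ Ioo (min q x) (max q x) := by
      have h1 : m ≠ q := fun h => by rw [h] at hme; linarith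
      have h2 : m ≠ x := fun h => by rw [h] at hme; linarith
      refine ⟨lt_of_le_of_ne hm.1 fun h => ?_, lt_of_le_of_ne hm.2 fun h => ?_⟩
      · rcases min_choice q x with h3 | h3 <;> rw [h3] at h <;> simp_all
      · rcases max_choice q x with h3 | h3 <;> rw [h3] at h <;> simp_all
    have hloc : IsLocalMax V m := by
      filter_upwards [Ioo_mem_nhds hm'.1 hm'.2] with s hs
      exact hmax (Ioo_subset_Icc_self hs)
    have h1 := not_critical_of_left_max hV hnd hs hm'.1
      (fun s hs => hmax ⟨hs.1.le, hs.2.le.trans hm.2⟩) hloc.deriv_eq_zero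
    have h2 : V m ≤ e' := well_subset (uIcc_subset_well (hsub hq1) hx hm)
    rw [abs_of_nonpos (by linarith)] at h1
    linarith
  -- Both actions become integrals over the same well, since the root vanishes on the added part.
  have hext : ∫ s in well V e q, √(2 * (e - V s)) = ∫ s in well V e' q, √(2 * (e - V s)) :=
    (MeasureTheory.setIntegral_eq_of_subset_of_forall_sdiff_eq_zero hmeas hsub fun x hx =>
      Real.sqrt_eq_zero_of_nonpos (by linarith [hout x hx])).symm
  have hint : ∀ E : ℝ, MeasureTheory.IntegrableOn (fun s => √(2 * (E - V s))) (well V e' q) :=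
    fun E => ((by fun_prop : Continuous fun s => √(2 * (E - V s))).continuousOn.integrableOn_compact
      hcomp).mono_set well_subset
  have hdiff : |(∫ s in well V e q, √(2 * (e - V s))) - ∫ s in well V e' q, √(2 * (e' - V s))| ≤
      √(2 * η) * MeasureTheory.volume.real {s | V s ≤ e'} := by
    rw [hext, ← MeasureTheory.integral_sub (hint e) (hint e'), ← Real.norm_eq_abs]
    have hfin : MeasureTheory.volume (well V e' q) < ⊤ :=
      (MeasureTheory.measure_mono well_subset).trans_lt hcomp.measure_lt_top
    refine (MeasureTheory.norm_setIntegral_le_of_norm_le_const hfin (C := √(2 * η))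
      fun s _ => abs_sqrt_sub_sqrt_le (by rw [he]; ring) (by linarith)).trans ?_
    gcongr
    · exact hcomp.measure_lt_top.ne
    · exact well_subset
  have hact : action V w - action V y = 1 / Real.pi *
      ((∫ s in well V e q, √(2 * (e - V s))) - ∫ s in well V e' q, √(2 * (e' - V s))) := by
    unfold action
    rw [← hwy]
    ring
  rw [hact, abs_mul, abs_of_pos (by positivity)]
  gcongr

theorem mem_regularEnergies {V V' : ℝ → ℝ} {δ h e : ℝ} :
    e ∈ regularEnergies V V' δ h ↔ (⨅ q, V q) ≤ e ∧ e ≤ h - ⨅ q, V' q ∧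
      (∀ s ∈ saddles V, δ ≤ |e - V s|) ∧ ∀ s ∈ saddles V', δ ≤ |e - (h - V' s)| := by
  simp only [regularEnergies, Set.mem_sdiff, mem_Icc, mem_union, mem_iUnion, Metric.mem_ball,
    Real.dist_eq, exists_prop, not_or, not_exists, not_and, not_lt]
  tauto

/-- The branch of a leaf contains the leaves of all energies up to a nearby regular one. -/
theorem exists_mem_branch {V V' : ℝ → ℝ} {δ h η : ℝ} {w : ℝ × ℝ} (hη : 0 ≤ η) (hηδ : η < δ)
    (h1 : energy V w ∈ regularEnergies V V' δ h) (h2 : energy V w + η ∈ regularEnergies V V' δ h) :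
    ∃ y ∈ branch V V' δ h w, y.1 = w.1 ∧ energy V y = energy V w + η := by
  obtain ⟨σ, hσ, hσ'⟩ : ∃ σ : ℝ, σ ^ 2 = 1 ∧ σ * |w.2| = w.2 := by
    rcases le_total 0 w.2 with h | h
    · exact ⟨1, by simp, by rw [abs_of_nonneg h, one_mul]⟩
    · exact ⟨-1, by simp, by rw [abs_of_nonpos h]; ring⟩
  -- The path fixes the position and raises the kinetic energy by `s`; `σ` keeps the sign of the
  -- momentum.
  set γ : ℝ → ℝ × ℝ := fun s => (w.1, σ * √(w.2 ^ 2 + 2 * s)) with hγ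
  have hγe : ∀ s ∈ Icc 0 η, energy V (γ s) = energy V w + s := fun s hs => by
    simp only [hγ, energy]
    rw [mul_pow, hσ, Real.sq_sqrt (by nlinarith [sq_nonneg w.2, hs.1])]
    ring
  have hγ0 : γ 0 = w := by
    simp only [hγ, mul_zero, add_zero, Real.sqrt_sq_eq_abs, hσ']
  have hpre : IsPreconnected (γ '' Icc 0 η) :=
    isPreconnected_Icc.image γ (by fun_prop : Continuous γ).continuousOn
  rw [mem_regularEnergies] at h1 h2
  have hreg : γ '' Icc 0 η ⊆ {y | energy V y ∈ regularEnergies V V' δ h} := by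
    rintro _ ⟨s, hs, rfl⟩
    rw [mem_ofPred_eq, hγe s hs, mem_regularEnergies]
    -- Two energies less than `δ` apart, both at distance at least `δ` from `v`, lie on the same
    -- side of `v`.
    have key : ∀ v, δ ≤ |energy V w - v| → δ ≤ |energy V w + η - v| → δ ≤ |energy V w + s - v| := by
      intro v k1 k2
      rw [le_abs] at *
      rcases k1 with k1 | k1
      · left; linarith [hs.1]
      · rcases k2 with k2 | k2
        · linarith
        · right; linarith [hs.2]
    exact ⟨by linarith [hs.1, h1.1], by linarith [hs.2, h2.2.1],
      fun v hv => key _ (h1.2.2.1 v hv) (h2.2.2.1 v hv),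
      fun v hv => key _ (h1.2.2.2 v hv) (h2.2.2.2 v hv)⟩
  refine ⟨γ η, hpre.subset_connectedComponentIn ⟨0, left_mem_Icc.2 hη, hγ0⟩ hreg
    ⟨η, right_mem_Icc.2 hη, rfl⟩, rfl, hγe η (right_mem_Icc.2 hη)⟩

theorem IsS3B.contDiff_two {r : ℕ} (hr : 3 < r) {V : ℝ → ℝ} (hV : IsS3B r V) : ContDiff ℝ 2 V :=
  hV.smooth.of_le (by exact_mod_cast (by omega : 2 ≤ r + 1))

/-- The leaves of initial points cross the wall with a uniform transversality. -/
theorem exists_energy_gap {r : ℕ} (hr : 3 < r) {V₁ V₂ : ℝ → ℝ} (hV₂ : IsS3B r V₂)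
    {h δ ρ : ℝ} (hδ : 0 < δ) (hρ : 0 < ρ) (hh : V₁ 0 ∈ regularEnergies V₁ V₂ δ h) :
    ∃ c > 0, ∀ a ∈ initialPoints V₁ V₂ h δ ρ, V₁ 0 + c ≤ energy V₁ (q₁ a, p₁ a) := by
  set L := MeasureTheory.volume.real {s | V₂ s ≤ h - V₁ 0}
  have hL : 0 ≤ L := MeasureTheory.measureReal_nonneg
  have hπ := Real.pi_pos
  have hk : 0 < Real.pi * ρ / (L + 1) := by positivity
  -- A gap below `δ` keeps the tangent leaf in the same branch; a gap below the second value makes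
  -- the Hölder bound `√(2 * η) * L / π` smaller than `ρ`. Using `L + 1` avoids division by zero.
  refine ⟨min δ ((Real.pi * ρ / (L + 1)) ^ 2 / 2), lt_min hδ (by positivity), fun a ha => ?_⟩
  obtain ⟨-, -, hE, hw, hreg, hact⟩ := ha
  by_contra hlt
  rw [not_le] at hlt
  set e := energy V₁ (q₁ a, p₁ a)
  set w := (q₂ a, p₂ a)
  have hE' : e + energy V₂ w = h := hE
  set η := e - V₁ 0 with hη
  have hη0 : 0 ≤ η := sub_nonneg.2 (well_subset hw)
  have hη1 : η < δ := by linarith [min_le_left δ ((Real.pi * ρ / (L + 1)) ^ 2 / 2)]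
  have hη2 : 2 * η < (Real.pi * ρ / (L + 1)) ^ 2 := by
    linarith [min_le_right δ ((Real.pi * ρ / (L + 1)) ^ 2 / 2)]
  have heq : energy V₂ w + η = h - V₁ 0 := by rw [hη]; linarith
  -- The map `e ↦ h - e` exchanges the regular energies of the two subsystems, so regularity of `V₁
  -- 0` is regularity of the tangent energy.
  have hreg' : energy V₂ w + η ∈ regularEnergies V₂ V₁ δ h := by
    rw [mem_regularEnergies] at hh ⊢
    rw [heq]
    refine ⟨by linarith [hh.2.1], by linarith [hh.1], fun s hs => ?_, fun s hs => ?_⟩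
    · have := hh.2.2.2 s hs
      rw [abs_sub_comm] at this
      convert this using 2
      ring
    · have := hh.2.2.1 s hs
      rw [abs_sub_comm] at this
      convert this using 2
      ring
  obtain ⟨y, hy, hy1, hye⟩ := exists_mem_branch hη0 hη1 hreg hreg'
  have h1 := hact y hy (by rw [hye, heq])
  have h2 := abs_action_sub_le (hV₂.contDiff_two hr) hV₂.nondegenerate hV₂.coercive hy1.symm hye
    hη0 hη1 (mem_regularEnergies.1 hreg).2.2.1
  rw [hye, heq] at h2
  have h3 : √(2 * η) < Real.pi * ρ / (L + 1) := (Real.sqrt_lt' hk).2 hη2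
  have h4 : √(2 * η) * L < Real.pi * ρ := by
    rw [lt_div_iff₀ (by linarith)] at h3
    nlinarith [Real.sqrt_nonneg (2 * η)]
  have h5 : 1 / Real.pi * (√(2 * η) * L) < ρ := by
    rw [one_div_mul_eq_div, div_lt_iff₀ hπ]
    linarith
  linarith

/-! ### One-degree-of-freedom motion from a turning point -/

/-- `(q, p)` is a motion of the Hamiltonian system `p ^ 2 / 2 + V q`. -/
structure IsMotion (V q p : ℝ → ℝ) : Prop where
  pos : ∀ t, HasDerivAt q (p t) t
  mom : ∀ t, HasDerivAt p (-deriv V (q t)) t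

theorem IsMotion.energy_eq {V q p : ℝ → ℝ} (hV : Differentiable ℝ V) (h : IsMotion V q p)
    (s t : ℝ) : energy V (q t, p t) = energy V (q s, p s) := by
  have hd : ∀ t, HasDerivAt (fun t => energy V (q t, p t)) 0 t := fun t => by
    have h1 := (((h.mom t).pow 2).div_const 2).add ((hV (q t)).hasDerivAt.comp t (h.pos t))
    refine h1.congr_deriv ?_
    push_cast
    ring
  exact is_const_of_deriv_eq_zero (fun t => (hd t).differentiableAt) (fun t => (hd t).deriv) t s

theorem le_deriv_of_slope_bound {V : ℝ → ℝ} {g x : ℝ} (hV : DifferentiableAt ℝ V x) (hx : 0 < x)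
    (hg : ∀ y ∈ Icc 0 x, g * (x - y) ≤ V x - V y) : g ≤ deriv V x := by
  have hs := hasDerivAt_iff_tendsto_slope.1 hV.hasDerivAt
  refine ge_of_tendsto (hs.mono_left (nhdsWithin_mono x fun y (hy : y ∈ Iio x) => ne_of_lt hy)) ?_
  filter_upwards [Ioo_mem_nhdsLT hx] with y hy
  rw [slope_def_field, ← neg_sub (V x), ← neg_sub x, neg_div_neg_eq, le_div_iff₀ (by linarith [hy.2])]
  exact hg y ⟨hy.1.le, hy.2.le⟩

theorem IsMotion.eventually_neg {V q p : ℝ → ℝ} (h : IsMotion V q p) (hp : p 0 = 0)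
    (hd : 0 < deriv V (q 0)) : ∀ᶠ t in 𝓝[>] (0 : ℝ), p t < 0 := by
  have hs := hasDerivAt_iff_tendsto_slope.1 (h.mom 0)
  have h1 : ∀ᶠ t in 𝓝[>] (0 : ℝ), slope p 0 t < 0 :=
    (hs.mono_left (nhdsWithin_mono 0 fun y (hy : y ∈ Ioi 0) => ne_of_gt hy)).eventually
      (gt_mem_nhds (by linarith))
  filter_upwards [h1, self_mem_nhdsWithin] with t ht ht0
  rw [slope_def_field, hp, sub_zero, sub_zero] at ht
  by_contra hn
  exact absurd ht (not_lt.2 (div_nonneg (not_lt.1 hn) (le_of_lt ht0)))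

theorem nonneg_of_pos_before {f : ℝ → ℝ} (hf : Continuous f) {T : ℝ}
    (h : ∀ t ∈ Ico 0 T, 0 < f t) (hT : 0 < T) : ∀ t ∈ Icc 0 T, 0 ≤ f t := by
  intro t ht
  have : closure (Ico 0 T) ⊆ {t | 0 ≤ f t} :=
    closure_minimal (fun t ht => (h t ht).le) (isClosed_le continuous_const hf)
  rw [closure_Ico hT.ne] at this
  exact this ht

section Turning

variable {V q p : ℝ → ℝ} {x g : ℝ}

/-- At a first later zero of `p`, energy conservation would give `V q = V x` at a point `0 ≤ q < x`,
against the slope bound. -/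
theorem IsMotion.neg_of_turning (h : IsMotion V q p) (hV : Differentiable ℝ V) (hx : 0 < x)
    (hg0 : 0 < g) (hg : ∀ y ∈ Icc 0 x, g * (x - y) ≤ V x - V y) (hq0 : q 0 = x) (hp0 : p 0 = 0)
    {T : ℝ} (hT : ∀ t ∈ Ico 0 T, 0 < q t) : ∀ t ∈ Ioc 0 T, p t < 0 := by
  intro t₂ ht₂
  by_contra hn
  rw [not_lt] at hn
  have hqc : Continuous q := continuous_iff_continuousAt.2 fun t => (h.pos t).continuousAt
  have hpc : Continuous p := continuous_iff_continuousAt.2 fun t => (h.mom t).continuousAt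
  have hev := h.eventually_neg hp0 (by
    rw [hq0]
    exact hg0.trans_le (le_deriv_of_slope_bound (hV x) hx hg))
  obtain ⟨b, hb, hbs⟩ := (mem_nhdsGT_iff_exists_Ioo_subset' ht₂.1).1 hev
  set k := min b t₂ / 2
  have hk0 : 0 < k := half_pos (lt_min hb ht₂.1)
  have hkb : k < b := by
    have := min_le_left b t₂
    simp only [k]; linarith [mem_Ioi.1 hb]
  have hkt : k < t₂ := by
    have := min_le_right b t₂
    simp only [k]; linarith [ht₂.1]
  obtain ⟨t₃, ht₃, hz, hbefore⟩ := exists_first_zero (f := fun t => -p t) hkt.le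
    hpc.neg.continuousOn (by have := hbs ⟨hk0, hkb⟩; simpa using this) (by linarith)
  have ht₃0 : 0 < t₃ := hk0.trans ht₃.1
  have hneg : ∀ t ∈ Ioo 0 t₃, p t < 0 := fun t ht => by
    rcases lt_or_ge t b with h1 | h1
    · exact hbs ⟨ht.1, h1⟩
    · have := hbefore t ⟨hkb.le.trans h1, ht.2⟩
      linarith
  have hanti : StrictAntiOn q (Icc 0 t₃) := by
    refine strictAntiOn_of_deriv_neg (convex_Icc _ _) hqc.continuousOn fun t ht => ?_
    rw [interior_Icc] at ht
    rw [(h.pos t).deriv]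
    exact hneg t ht
  have h1 := hanti (left_mem_Icc.2 ht₃0.le) (right_mem_Icc.2 ht₃0.le) ht₃0
  rw [hq0] at h1
  have h2 : 0 ≤ q t₃ := nonneg_of_pos_before hqc hT (ht₂.1.trans_le ht₂.2) t₃
    ⟨ht₃0.le, ht₃.2.trans ht₂.2⟩
  have h3 := h.energy_eq hV 0 t₃
  have h4 := hg _ ⟨h2, h1.le⟩
  have h5 : p t₃ = 0 := by simpa using hz
  simp only [energy, h5, hp0, hq0] at h3
  have : 0 < g * (x - q t₃) := mul_pos hg0 (by linarith)
  linarith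

/-- Energy conservation and the slope bound give `p ^ 2 ≥ 2 * g * (x - q)`, so `√(x - q)` grows at
rate at least `√(g / 2)`. The root is differentiated only at positive times, away from the turning
point. -/
theorem IsMotion.le_of_turning (h : IsMotion V q p) (hV : Differentiable ℝ V) (hx : 0 < x)
    (hg0 : 0 < g) (hg : ∀ y ∈ Icc 0 x, g * (x - y) ≤ V x - V y) (hq0 : q 0 = x) (hp0 : p 0 = 0)
    {T : ℝ} (hT0 : 0 < T) (hT : ∀ t ∈ Ico 0 T, 0 < q t) :
    ∀ t ∈ Icc 0 T, p t ≤ -(g * t) ∧ g * t ^ 2 / 2 ≤ x - q t := by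
  have hqc : Continuous q := continuous_iff_continuousAt.2 fun t => (h.pos t).continuousAt
  have hneg := h.neg_of_turning hV hx hg0 hg hq0 hp0 hT
  have hnn := nonneg_of_pos_before hqc hT hT0
  have hanti : StrictAntiOn q (Icc 0 T) := by
    refine strictAntiOn_of_deriv_neg (convex_Icc _ _) hqc.continuousOn fun t ht => ?_
    rw [interior_Icc] at ht
    rw [(h.pos t).deriv]
    exact hneg t ⟨ht.1, ht.2.le⟩
  have hlt : ∀ t ∈ Ioc 0 T, q t < x := fun t ht => by
    rw [← hq0]
    exact hanti (left_mem_Icc.2 hT0.le) ⟨ht.1.le, ht.2⟩ ht.1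
  have hpq : ∀ t ∈ Icc 0 T, 2 * g * (x - q t) ≤ p t ^ 2 := fun t ht => by
    have h3 := h.energy_eq hV 0 t
    have hle : q t ≤ x := by
      rw [← hq0]
      exact hanti.antitoneOn (left_mem_Icc.2 hT0.le) ht ht.1
    have h4 := hg _ ⟨hnn t ht, hle⟩
    simp only [energy, hp0, hq0] at h3
    linarith
  have hmono : MonotoneOn (fun t => √(x - q t) - √(g / 2) * t) (Icc 0 T) := by
    have hder : ∀ t ∈ Ioo 0 T, HasDerivAt (fun t => √(x - q t) - √(g / 2) * t)
        (-p t / (2 * √(x - q t)) - √(g / 2)) t := fun t ht => by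
      have h1 := ((h.pos t).const_sub x).sqrt (by linarith [hlt t ⟨ht.1, ht.2.le⟩])
      have h2 := (hasDerivAt_id t).const_mul (√(g / 2))
      rw [mul_one] at h2
      exact h1.sub h2
    refine monotoneOn_of_deriv_nonneg (convex_Icc _ _) (by fun_prop) (fun t ht => ?_)
      fun t ht => ?_
    · rw [interior_Icc] at ht
      exact (hder t ht).differentiableAt.differentiableWithinAt
    · rw [interior_Icc] at ht
      rw [(hder t ht).deriv, sub_nonneg, le_div_iff₀
        (by have := Real.sqrt_pos.2 (sub_pos.2 (hlt t ⟨ht.1, ht.2.le⟩)); linarith)]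
      have hp := hneg t ⟨ht.1, ht.2.le⟩
      have hu := sub_pos.2 (hlt t ⟨ht.1, ht.2.le⟩)
      refine le_of_sq_le_sq ?_ (by linarith)
      rw [mul_pow, mul_pow, Real.sq_sqrt (by positivity), Real.sq_sqrt hu.le, neg_sq]
      linarith [hpq t ⟨ht.1.le, ht.2.le⟩]
  intro t ht
  have h1 := hmono (left_mem_Icc.2 hT0.le) ht ht.1
  simp only [hq0, sub_self, Real.sqrt_zero, mul_zero] at h1
  have hu : 0 ≤ x - q t := by
    rcases eq_or_lt_of_le ht.1 with h0 | h0
    · rw [← h0, hq0, sub_self]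
    · linarith [hlt t ⟨h0, ht.2⟩]
  have h2 : g * t ^ 2 / 2 ≤ x - q t := by
    have h3 : √(g / 2) * t ≤ √(x - q t) := by linarith
    have h4 := pow_le_pow_left₀ (mul_nonneg (Real.sqrt_nonneg _) ht.1) h3 2
    rw [mul_pow, Real.sq_sqrt (by positivity), Real.sq_sqrt hu] at h4
    linarith
  refine ⟨?_, h2⟩
  have hp : p t ≤ 0 := by
    rcases eq_or_lt_of_le ht.1 with h0 | h0
    · rw [← h0, hp0]
    · exact (hneg t ⟨h0, ht.2⟩).le
  have h5 : (g * t) ^ 2 ≤ (-p t) ^ 2 := by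
    rw [neg_sq]
    nlinarith [hpq t ht]
  have := le_of_sq_le_sq h5 (by linarith)
  linarith

/-- A motion that starts at a turning point crosses `q = 0`. -/
theorem IsMotion.exists_crossing (h : IsMotion V q p) (hV : Differentiable ℝ V) (hx : 0 < x)
    (hg0 : 0 < g) (hg : ∀ y ∈ Icc 0 x, g * (x - y) ≤ V x - V y) (hq0 : q 0 = x)
    (hp0 : p 0 = 0) : ∃ t₀ > 0, q t₀ = 0 ∧ (∀ t ∈ Ico 0 t₀, 0 < q t) ∧
      (∀ t ∈ Icc 0 t₀, p t ≤ -(g * t)) ∧ g * t₀ ^ 2 / 2 ≤ x := by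
  have hqc : Continuous q := continuous_iff_continuousAt.2 fun t => (h.pos t).continuousAt
  obtain ⟨b, hb0, hb⟩ : ∃ b, 0 ≤ b ∧ q b ≤ 0 := by
    by_contra hn
    push Not at hn
    -- By this time the quadratic bound forces the distance travelled to be at least `x`.
    set T := √(2 * x / g) with hT
    have hT0 : 0 < T := Real.sqrt_pos.2 (by positivity)
    have := (h.le_of_turning hV hx hg0 hg hq0 hp0 hT0 (fun t ht => hn t ht.1) T
      (right_mem_Icc.2 hT0.le)).2
    rw [hT, Real.sq_sqrt (by positivity), mul_div_cancel₀ _ hg0.ne'] at this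
    linarith [hn T hT0.le]
  obtain ⟨t₀, ht₀, hz, hbef⟩ := exists_first_zero hb0 hqc.continuousOn (by rw [hq0]; exact hx) hb
  have hall := h.le_of_turning hV hx hg0 hg hq0 hp0 ht₀.1 hbef
  refine ⟨t₀, ht₀.1, hz, hbef, fun t ht => (hall t ht).1, ?_⟩
  have := (hall t₀ (right_mem_Icc.2 ht₀.1.le)).2
  rwa [hz, sub_zero] at this

end Turning

/-! ### The part of the leaf behind the wall -/

/-- The leftmost point of a leaf that crosses `q = 0`. -/
theorem exists_left_turning {V : ℝ → ℝ} (hV : ContDiff ℝ 2 V)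
    (hnd : ∀ q, deriv V q = 0 → deriv (deriv V) q ≠ 0) (hco : Tendsto V (cocompact ℝ) atTop)
    {e δ : ℝ} (hδ : 0 < δ) (he : V 0 < e) (hs : ∀ s ∈ saddles V, δ ≤ |e - V s|) :
    ∃ c > 0, sInf (well V e 0) = -c ∧ V (-c) = e ∧
      ∃ g > 0, ∀ y ∈ Icc 0 c, g * (c - y) ≤ V (-c) - V (-y) := by
  obtain ⟨R, hR⟩ := (isCompact_sublevel hV.continuous hco e).isBounded.subset_closedBall 0
  have hR0 : 0 ≤ R := by
    have : (0 : ℝ) ∈ Metric.closedBall (0 : ℝ) R := hR he.le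
    simpa using this
  have hb : e < V (-(R + 1)) := by
    by_contra hn
    have := hR (not_lt.1 hn : V (-(R + 1)) ≤ e)
    rw [Metric.mem_closedBall, dist_zero_right, norm_neg, Real.norm_eq_abs,
      abs_of_nonneg (by linarith)] at this
    linarith
  have hVc := hV.continuous
  obtain ⟨c, hc, hz, hbef⟩ := exists_first_zero (f := fun s => e - V (-s)) (a := 0) (b := R + 1)
    (by linarith) (by fun_prop) (by simpa using he) (by linarith)
  have hVc' : V (-c) = e := by linarith
  -- Mirroring turns `-c` into a right turning point, to which the slope bound applies.
  set W : ℝ → ℝ := fun s => V (-s) with hW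
  have hW1 : deriv W = fun s => -deriv V (-s) := by
    ext s; exact deriv_comp_neg V s
  have hW2 : ∀ s, deriv (deriv W) s = deriv (deriv V) (-s) := fun s => by
    rw [hW1, deriv.fun_neg, deriv_comp_neg, neg_neg]
  have hWd : ContDiff ℝ 2 W := hV.comp contDiff_neg
  have hmem : c ∈ turningPoints W δ (e - V 0) c := by
    refine ⟨⟨hc.1.le, le_rfl⟩, ?_, fun s hs' => ?_, fun θ hθ => ?_⟩
    · simp only [hW, neg_zero, hVc']; linarith
    · simp only [hW, hVc']
      refine hs (-s) ⟨?_, ?_⟩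
      · have := hs'.1
        rw [hW1] at this
        simpa using this
      · rw [← hW2]; exact hs'.2
    · simp only [hW, hVc']
      rcases eq_or_lt_of_le hθ.2 with h1 | h1
      · rw [h1, one_mul, hVc']
      · have := hbef (θ * c) ⟨mul_nonneg hθ.1 hc.1.le, by nlinarith [hc.1]⟩
        linarith
  obtain ⟨g, hg0, hg⟩ := exists_slope_bound hWd (fun s h1 => by
    rw [hW2]
    rw [hW1] at h1
    exact hnd _ (by simpa using h1)) hδ (sub_pos.2 he) c
  have hgc := hg c hmem
  have hgd := hg0.trans_le (le_deriv_of_slope_bound (hWd.differentiable (by simp) c) hc.1 hgc)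
  refine ⟨c, hc.1, ?_, hVc', g, hg0, hgc⟩
  have hsub : Icc (-c) 0 ⊆ well V e 0 :=
    isPreconnected_Icc.subset_connectedComponentIn ⟨by linarith [hc.1], le_rfl⟩ fun s hs => by
      rcases eq_or_lt_of_le hs.1 with h1 | h1
      · exact h1 ▸ hVc'.le
      · have h2 := hbef (-s) ⟨by linarith [hs.2], by linarith⟩
        rw [neg_neg] at h2
        exact (by linarith : V s ≤ e)
  have hcw : -c ∈ well V e 0 := hsub (left_mem_Icc.2 (by linarith [hc.1]))
  refine IsLeast.csInf_eq ⟨hcw, fun x hx => ?_⟩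
  by_contra hlt
  rw [not_le] at hlt
  -- The slope at `c` is positive, so the potential exceeds `e` immediately to the left of `-c` and
  -- the well ends there.
  have hss := hasDerivAt_iff_tendsto_slope.1 (hWd.differentiable (by simp) c).hasDerivAt
  have h1 : ∀ᶠ t in 𝓝[>] c, 0 < slope W c t :=
    (hss.mono_left (nhdsWithin_mono c fun y (hy : y ∈ Ioi c) => ne_of_gt hy)).eventually
      (lt_mem_nhds hgd)
  obtain ⟨y, hy, hy'⟩ := (h1.and (Ioo_mem_nhdsGT (show c < -x by linarith))).exists
  have h2 : V (-y) ≤ e := well_subset (uIcc_subset_well hx hcw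
    (by rw [uIcc_of_le hlt.le]; constructor <;> linarith [hy'.1, hy'.2]))
  rw [slope_def_field] at hy
  have h3 : W y - W c ≤ 0 := by simp only [hW, hVc']; linarith
  exact absurd hy (not_lt.2 (div_nonpos_of_nonpos_of_nonneg h3 (by linarith [hy'.1])))

/-- Substituting `s = q t` turns `dq / p` into `dt`. Open intervals leave out the turning point,
where the integrand may be singular. -/
theorem travelTime_eq {V q p : ℝ → ℝ} (hV : Differentiable ℝ V) (h : IsMotion V q p)
    {c s₀ e : ℝ} (hs₀ : 0 < s₀) (he : energy V (q 0, p 0) = e) (hinf : sInf (well V e 0) = -c)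
    (hc : 0 < c) (hq0 : q 0 = -c) (hqs : q s₀ = 0) (hpos : ∀ t ∈ Ioc 0 s₀, 0 < p t) :
    travelTime V e = 2 * s₀ := by
  have hqc : Continuous q := continuous_iff_continuousAt.2 fun t => (h.pos t).continuousAt
  have hmono : StrictMonoOn q (Icc 0 s₀) := by
    refine strictMonoOn_of_deriv_pos (convex_Icc _ _) hqc.continuousOn fun t ht => ?_
    rw [interior_Icc] at ht
    rw [(h.pos t).deriv]
    exact hpos t ⟨ht.1, ht.2.le⟩
  have himg : q '' Ioo 0 s₀ = Ioo (-c) 0 := by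
    refine Subset.antisymm ?_ ?_
    · rintro _ ⟨t, ht, rfl⟩
      have h1 := hmono (left_mem_Icc.2 hs₀.le) ⟨ht.1.le, ht.2.le⟩ ht.1
      have h2 := hmono ⟨ht.1.le, ht.2.le⟩ (right_mem_Icc.2 hs₀.le) ht.2
      rw [hq0] at h1
      rw [hqs] at h2
      exact ⟨h1, h2⟩
    · have := intermediate_value_Ioo hs₀.le hqc.continuousOn
      rwa [hq0, hqs] at this
  have hint : ∫ s in Ioo (-c) 0, 1 / √(2 * (e - V s)) = s₀ := by
    rw [← himg, MeasureTheory.integral_image_eq_integral_abs_deriv_smul measurableSet_Ioo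
      (fun t _ => (h.pos t).hasDerivWithinAt)
      (hmono.injOn.mono Ioo_subset_Icc_self),
      MeasureTheory.setIntegral_congr_fun (g := fun _ => (1 : ℝ)) measurableSet_Ioo]
    · simp [hs₀.le]
    · intro t ht
      have hp := hpos t ⟨ht.1, ht.2.le⟩
      have h1 := h.energy_eq hV 0 t
      rw [he] at h1
      have h2 : 2 * (e - V (q t)) = p t ^ 2 := by
        rw [← h1]; simp only [energy]; ring
      simp only [h2, Real.sqrt_sq hp.le, abs_of_pos hp, smul_eq_mul]
      field_simp
  rw [travelTime, hinf, intervalIntegral.integral_of_le (by linarith),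
    MeasureTheory.integral_Ioc_eq_integral_Ioo, hint]

/-! ### The Hamiltonian vector fields -/

section Fields

variable {V₁ V₂ : ℝ → ℝ} {Vr : ℝ × ℝ → ℝ}

theorem contDiff_hamField {n m : WithTop ℕ∞} {H : Phase → ℝ} (hH : ContDiff ℝ n H)
    (hmn : m + 1 ≤ n) : ContDiff ℝ m (hamField H) := by
  have h : ∀ v : Phase, ContDiff ℝ m (fun z => fderiv ℝ H z v) := fun v =>
    (hH.fderiv_right hmn).clm_apply contDiff_const
  exact (h _).prodMk ((h _).neg.prodMk ((h _).prodMk (h _).neg))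

theorem contDiff_lift {n : WithTop ℕ∞} (hVr : ContDiff ℝ n Vr) : ContDiff ℝ n (lift Vr) := by
  unfold lift q₁ q₂
  fun_prop

theorem contDiff_Ham {n : WithTop ℕ∞} (hV₁ : ContDiff ℝ n V₁) (hV₂ : ContDiff ℝ n V₂)
    (hVr : ContDiff ℝ n Vr) (ε : ℝ) : ContDiff ℝ n (Ham V₁ V₂ Vr ε) := by
  have := contDiff_lift hVr
  unfold Ham Hint energy q₁ p₁ q₂ p₂
  fun_prop

theorem hamField_Ham_zero (hV₁ : Differentiable ℝ V₁) (hV₂ : Differentiable ℝ V₂) (z : Phase) :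
    hamField (Ham V₁ V₂ Vr 0) z = (p₁ z, -deriv V₁ (q₁ z), p₂ z, -deriv V₂ (q₂ z)) := by
  have e1 : HasFDerivAt (fun z : Phase => z.1) (ContinuousLinearMap.fst ℝ ℝ (ℝ × ℝ × ℝ)) z :=
    hasFDerivAt_fst
  have e2 := hasFDerivAt_snd (𝕜 := ℝ) (p := z)
  have e3 := e2.fst
  have e4 := e2.snd
  have e5 := e4.fst
  have e6 := e4.snd
  have h := ((((e3.pow 2).mul_const (2⁻¹ : ℝ)).add ((hV₁ z.1).hasDerivAt.comp_hasFDerivAt z e1)).add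
    (((e6.pow 2).mul_const (2⁻¹ : ℝ)).add ((hV₂ z.2.2.1).hasDerivAt.comp_hasFDerivAt z e5)))
  have hH : HasFDerivAt (Ham V₁ V₂ Vr 0) _ z :=
    h.congr_of_eventuallyEq (Eventually.of_forall fun y => by
      simp [Ham, Hint, energy, q₁, p₁, q₂, p₂, div_eq_mul_inv])
  unfold hamField
  rw [hH.fderiv]
  simp [q₁, p₁, q₂, p₂]

theorem hamField_Ham (hV₁ : Differentiable ℝ V₁) (hV₂ : Differentiable ℝ V₂)
    (hVr : Differentiable ℝ Vr) (ε : ℝ) (z : Phase) :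
    hamField (Ham V₁ V₂ Vr ε) z =
      hamField (Ham V₁ V₂ Vr 0) z + ε • hamField (lift Vr) z := by
  have hH : Differentiable ℝ (Hint V₁ V₂) := by
    unfold Hint energy q₁ p₁ q₂ p₂
    fun_prop
  have hl : Differentiable ℝ (lift Vr) := by
    unfold lift q₁ q₂
    fun_prop
  have h : ∀ ε, fderiv ℝ (Ham V₁ V₂ Vr ε) z = fderiv ℝ (Hint V₁ V₂) z + ε • fderiv ℝ (lift Vr) z :=
    fun ε => ((hH z).hasFDerivAt.add ((hl z).hasFDerivAt.const_smul ε)).fderiv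
  unfold hamField
  rw [h ε, h 0]
  ext <;> simp <;> ring

/-- The coupling does not involve the momenta, so `q₁' = p₁` persists under perturbation and the
sign of `p₁` controls the crossings of the wall. -/
theorem q₁_hamField_lift (hVr : Differentiable ℝ Vr) (z : Phase) :
    q₁ (hamField (lift Vr) z) = 0 := by
  have e1 : HasFDerivAt (fun z : Phase => z.1) (ContinuousLinearMap.fst ℝ ℝ (ℝ × ℝ × ℝ)) z :=
    hasFDerivAt_fst
  have e5 := (hasFDerivAt_snd (𝕜 := ℝ) (p := z)).snd.fst
  have h : HasFDerivAt (lift Vr) _ z := (hVr (z.1, z.2.2.1)).hasFDerivAt.comp z (e1.prodMk e5)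
  unfold hamField q₁
  simp only
  rw [h.fderiv]
  simp only [ContinuousLinearMap.comp_apply, ContinuousLinearMap.prod_apply,
    ContinuousLinearMap.coe_fst', ContinuousLinearMap.coe_snd']
  exact map_zero (fderiv ℝ Vr (z.1, z.2.2.1))

end Fields

/-! ### Cutting off the vector fields -/

theorem exists_cutoff (R : ℝ) (hR : 0 ≤ R) : ∃ χ : Phase → ℝ, ContDiff ℝ 2 χ ∧
    HasCompactSupport χ ∧ ∀ z, ‖z‖ ≤ R + 1 → χ z = 1 := by
  let f : ContDiffBump (0 : Phase) := ⟨R + 1, R + 2, by linarith, by linarith⟩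
  exact ⟨f, f.contDiff, f.hasCompactSupport, fun z hz => f.one_of_mem_closedBall (by simpa using hz)⟩

/-- A pair of tame vector fields that agree with `X` and `Y` on the ball of radius `R + 1`, the
first of them being proportional to `X` with coefficient `χ`. -/
structure IsCutoff (X Y : Phase → Phase) (R : ℝ) (χ : Phase → ℝ) (F G : Phase → Phase)
    (K : ℝ≥0) : Prop where
  one_le : 1 ≤ K
  tame_left : IsTame F K
  tame_right : IsTame G K
  smul_eq : ∀ z, F z = χ z • X z
  left_eq : ∀ z, ‖z‖ ≤ R + 1 → F z = X z
  right_eq : ∀ z, ‖z‖ ≤ R + 1 → G z = Y z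

theorem exists_isCutoff {X Y : Phase → Phase} (hX : ContDiff ℝ 2 X) (hY : ContDiff ℝ 2 Y)
    {R : ℝ} (hR : 0 ≤ R) : ∃ χ F G K, IsCutoff X Y R χ F G K := by
  obtain ⟨χ, h1, h2, h3⟩ := exists_cutoff R hR
  obtain ⟨K₁, hK₁⟩ := exists_isTame (h1.smul hX) h2.smul_right
  obtain ⟨K₂, hK₂⟩ := exists_isTame (h1.smul hY) h2.smul_right
  refine ⟨χ, _, _, max 1 (max K₁ K₂), le_max_left _ _,
    hK₁.mono ((le_max_left _ _).trans (le_max_right _ _)),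
    hK₂.mono ((le_max_right _ _).trans (le_max_right _ _)), fun z => rfl, fun z hz => ?_,
    fun z hz => ?_⟩ <;> simp [h3 z hz]

/-- The margin between `R` and `R + 1` makes the fields agree on a neighbourhood of `z`. -/
theorem IsCutoff.fderiv_eq {X Y : Phase → Phase} {R : ℝ} {χ : Phase → ℝ} {F G : Phase → Phase}
    {K : ℝ≥0} (h : IsCutoff X Y R χ F G K) {z : Phase} (hz : ‖z‖ ≤ R) :
    fderiv ℝ F z = fderiv ℝ X z := by
  refine Filter.EventuallyEq.fderiv_eq ?_
  have : ∀ᶠ y in 𝓝 z, ‖y‖ < R + 1 := continuous_norm.continuousAt.eventually_lt_const (by linarith)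
  filter_upwards [this] with y hy using h.left_eq y hy.le

section Solutions

variable {X Y F G : Phase → Phase} {R : ℝ} {χ : Phase → ℝ} {K : ℝ≥0}

theorem IsCutoff.exists_solution (h : IsCutoff X Y R χ F G K) {ε : ℝ} (hε : |ε| ≤ 1) (t₀ : ℝ)
    (x₀ : Phase) : ∃ y : ℝ → Phase, y t₀ = x₀ ∧ ∀ t, HasDerivAt y (F (y t) + ε • G (y t)) t := by
  have hL := lipschitzWith_add_smul h.tame_left h.tame_right hε
  exact exists_global_solution (f := fun _ x => F x + ε • G x) (K := 2 * K) (B := 2 * K)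
    (h.one_le.trans (by rw [two_mul]; exact le_add_self)) (fun _ => hL)
    (fun x => continuous_const) (fun t => by
      push_cast; exact norm_speed_le h.tame_left h.tame_right hε 0) t₀ x₀

theorem IsCutoff.exists_solution_zero (h : IsCutoff X Y R χ F G K) (t₀ : ℝ) (x₀ : Phase) :
    ∃ z : ℝ → Phase, z t₀ = x₀ ∧ ∀ t, HasDerivAt z (F (z t)) t := by
  simpa using h.exists_solution (ε := 0) (by simp) t₀ x₀

theorem IsCutoff.exists_variation (h : IsCutoff X Y R χ F G K) {z : ℝ → Phase} (hz : Continuous z)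
    (t₀ : ℝ) (w₀ : Phase) :
    ∃ w : ℝ → Phase, w t₀ = w₀ ∧ ∀ t, HasDerivAt w (fderiv ℝ F (z t) (w t) + G (z t)) t := by
  have hfc : Continuous (fderiv ℝ F) := h.tame_left.fderiv_lipschitz.continuous
  have hGc : Continuous G := h.tame_right.lipschitz.continuous
  refine exists_global_solution (f := fun t w => fderiv ℝ F (z t) w + G (z t)) (K := K) (B := K)
    h.one_le (fun t => LipschitzWith.of_dist_le_mul fun x x' => ?_) (fun x => by fun_prop)
    (fun t => by simpa using h.tame_right.bound (z t)) t₀ w₀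
  rw [dist_add_right, dist_eq_norm, dist_eq_norm, ← map_sub]
  exact h.tame_left.norm_fderiv_le _ _

theorem IsCutoff.unique (h : IsCutoff X Y R χ F G K) {u v : ℝ → Phase}
    (hu : ∀ t, HasDerivAt u (X (u t)) t) (hv : ∀ t, HasDerivAt v (X (v t)) t)
    (hub : ∀ t, ‖u t‖ ≤ R) (hvb : ∀ t, ‖v t‖ ≤ R) {t₀ : ℝ} (h0 : u t₀ = v t₀) : u = v := by
  refine ODE_solution_unique_univ (v := fun _ => F) (s := fun _ => univ) (K := K)
    (fun _ => h.tame_left.lipschitz.lipschitzOnWith) (fun t => ⟨?_, trivial⟩)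
    (fun t => ⟨?_, trivial⟩) h0
  · rw [h.left_eq _ (by linarith [hub t])]; exact hu t
  · rw [h.left_eq _ (by linarith [hvb t])]; exact hv t

end Solutions

/-! ### The unperturbed motion -/

section Unperturbed

variable {V₁ V₂ : ℝ → ℝ} {X Y F G : Phase → Phase} {R : ℝ} {χ : Phase → ℝ} {K : ℝ≥0} {h : ℝ}

/-- The vector field of the separable Hamiltonian. -/
noncomputable def separableField (V₁ V₂ : ℝ → ℝ) (z : Phase) : Phase :=
  (p₁ z, -deriv V₁ (q₁ z), p₂ z, -deriv V₂ (q₂ z))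

theorem hasDerivAt_phase {z : ℝ → Phase} {v : Phase} {t : ℝ} :
    HasDerivAt z v t ↔ HasDerivAt (fun s => q₁ (z s)) (q₁ v) t ∧
      HasDerivAt (fun s => p₁ (z s)) (p₁ v) t ∧ HasDerivAt (fun s => q₂ (z s)) (q₂ v) t ∧
      HasDerivAt (fun s => p₂ (z s)) (p₂ v) t := by
  constructor
  · intro hz
    have a1 := hz.hasFDerivAt.fst.hasDerivAt
    have a2 := hz.hasFDerivAt.snd
    have a3 := a2.fst.hasDerivAt
    have a4 := a2.snd
    have a5 := a4.fst.hasDerivAt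
    have a6 := a4.snd.hasDerivAt
    simp at a1 a3 a5 a6
    exact ⟨a1, a3, a5, a6⟩
  · rintro ⟨a1, a2, a3, a4⟩
    exact a1.prodMk (a2.prodMk (a3.prodMk a4))

theorem isMotion_of_solution {z : ℝ → Phase}
    (hz : ∀ t, HasDerivAt z (separableField V₁ V₂ (z t)) t) :
    IsMotion V₁ (fun t => q₁ (z t)) (fun t => p₁ (z t)) :=
  ⟨fun t => (hasDerivAt_phase.1 (hz t)).1, fun t => (hasDerivAt_phase.1 (hz t)).2.1⟩

/-- Energy is conserved along the flow of the cut-off field. -/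
theorem Hint_eq_of_smul (hV₁ : Differentiable ℝ V₁) (hV₂ : Differentiable ℝ V₂) {z : ℝ → Phase}
    (hz : ∀ t, HasDerivAt z (χ (z t) • separableField V₁ V₂ (z t)) t) (s t : ℝ) :
    Hint V₁ V₂ (z t) = Hint V₁ V₂ (z s) := by
  have hd : ∀ t, HasDerivAt (fun t => Hint V₁ V₂ (z t)) 0 t := fun t => by
    obtain ⟨a1, a2, a3, a4⟩ := hasDerivAt_phase.1 (hz t)
    have h1 := (((a2.pow 2).div_const 2).add ((hV₁ (q₁ (z t))).hasDerivAt.comp t a1)).add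
      (((a4.pow 2).div_const 2).add ((hV₂ (q₂ (z t))).hasDerivAt.comp t a3))
    refine h1.congr_deriv ?_
    simp only [separableField, q₁, p₁, q₂, p₂, Prod.smul_fst, Prod.smul_snd, smul_eq_mul]
    push_cast
    ring
  exact is_const_of_deriv_eq_zero (fun t => (hd t).differentiableAt) (fun t => (hd t).deriv) t s

theorem exists_energy_bound {r : ℕ} (hV₁ : IsS3B r V₁) (hV₂ : IsS3B r V₂) (h : ℝ) :
    ∃ R ≥ 0, ∀ z, Hint V₁ V₂ z = h → ‖z‖ ≤ R := by
  obtain ⟨m₁, hm₁⟩ := hV₁.bddBelow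
  obtain ⟨m₂, hm₂⟩ := hV₂.bddBelow
  obtain ⟨R₁, hR₁⟩ := (isCompact_sublevel hV₁.smooth.continuous hV₁.coercive
    (h - m₂)).isBounded.subset_closedBall 0
  obtain ⟨R₂, hR₂⟩ := (isCompact_sublevel hV₂.smooth.continuous hV₂.coercive
    (h - m₁)).isBounded.subset_closedBall 0
  set P := 2 * (h - m₁ - m₂) + 1
  refine ⟨max 0 (max R₁ (max R₂ P)), le_max_left _ _, fun z hz => ?_⟩
  have b1 : m₁ ≤ V₁ (q₁ z) := hm₁ ⟨_, rfl⟩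
  have b2 : m₂ ≤ V₂ (q₂ z) := hm₂ ⟨_, rfl⟩
  simp only [Hint, energy] at hz
  have s1 := sq_nonneg (p₁ z)
  have s2 := sq_nonneg (p₂ z)
  have c1 : |q₁ z| ≤ R₁ := by
    simpa using hR₁ (show V₁ (q₁ z) ≤ h - m₂ by linarith)
  have c2 : |q₂ z| ≤ R₂ := by
    simpa using hR₂ (show V₂ (q₂ z) ≤ h - m₁ by linarith)
  have key : ∀ p : ℝ, p ^ 2 ≤ 2 * (h - m₁ - m₂) → |p| ≤ P := fun p hp => by
    rw [← sq_abs] at hp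
    nlinarith [sq_nonneg (|p| - 1)]
  have c3 := key (p₁ z) (by linarith)
  have c4 := key (p₂ z) (by linarith)
  simp only [Prod.norm_def, max_le_iff, Real.norm_eq_abs]
  simp only [q₁, p₁, q₂, p₂] at c1 c2 c3 c4
  refine ⟨c1.trans ?_, c3.trans ?_, c2.trans ?_, c4.trans ?_⟩ <;> simp

/-- The cut-off field is a scalar multiple of the original one and still conserves the energy. Its
orbits stay on the level `h`, inside the ball where nothing was cut off. -/
theorem IsCutoff.exists_smooth (hc : IsCutoff (separableField V₁ V₂) Y R χ F G K)
    (hV₁ : Differentiable ℝ V₁) (hV₂ : Differentiable ℝ V₂)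
    (hR : ∀ z, Hint V₁ V₂ z = h → ‖z‖ ≤ R) {a : Phase} (ha : Hint V₁ V₂ a = h) :
    ∃ z : ℝ → Phase, z 0 = a ∧ (∀ t, HasDerivAt z (separableField V₁ V₂ (z t)) t) ∧
      ∀ t, ‖z t‖ ≤ R := by
  obtain ⟨z, hz0, hz⟩ := hc.exists_solution_zero 0 a
  have hb : ∀ t, ‖z t‖ ≤ R := fun t => hR _ (by
    rw [Hint_eq_of_smul (χ := χ) hV₁ hV₂ (fun t => by rw [← hc.smul_eq]; exact hz t) 0 t, hz0, ha])
  exact ⟨z, hz0, fun t => by rw [← hc.left_eq _ (by linarith [hb t])]; exact hz t, hb⟩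

/-- Combine the time reversal of the first degree of freedom with the second one. -/
def splice (s : ℝ) (ζ z : ℝ → Phase) (t : ℝ) : Phase :=
  (q₁ (ζ (s - t)), -p₁ (ζ (s - t)), q₂ (z t), p₂ (z t))

/-- Each degree of freedom is autonomous and reversible, so motions of the two can be shifted,
reversed and paired freely. With `ζ = z` and `s = 2 * t₀` this yields the orbit after the impact. -/
theorem hasDerivAt_splice {ζ z : ℝ → Phase} (s : ℝ)
    (hζ : ∀ t, HasDerivAt ζ (separableField V₁ V₂ (ζ t)) t)
    (hz : ∀ t, HasDerivAt z (separableField V₁ V₂ (z t)) t) (t : ℝ) :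
    HasDerivAt (splice s ζ z) (separableField V₁ V₂ (splice s ζ z t)) t := by
  obtain ⟨a1, a2, -, -⟩ := hasDerivAt_phase.1 (hζ (s - t))
  obtain ⟨-, -, b3, b4⟩ := hasDerivAt_phase.1 (hz t)
  have c1 := a1.comp_const_sub s t
  have c2 := (a2.comp_const_sub s t).neg
  refine hasDerivAt_phase.2 ⟨?_, ?_, b3, b4⟩
  · exact c1
  · exact c2.congr_deriv (by simp [separableField, splice, q₁, p₁])

theorem norm_splice_le {ζ z : ℝ → Phase} (s : ℝ) (hζ : ∀ t, ‖ζ t‖ ≤ R) (hz : ∀ t, ‖z t‖ ≤ R)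
    (t : ℝ) : ‖splice s ζ z t‖ ≤ R := by
  have h1 := hζ (s - t)
  have h2 := hz t
  simp only [splice, Prod.norm_def, q₁, p₁, q₂, p₂, max_le_iff, norm_neg] at h1 h2 ⊢
  tauto

/-- Reflection of a motion in the configuration space. -/
theorem IsMotion.neg {q p V : ℝ → ℝ} (h : IsMotion V q p) :
    IsMotion (fun s => V (-s)) (fun t => -q t) (fun t => -p t) :=
  ⟨fun t => (h.pos t).neg, fun t => by
    refine (h.mom t).neg.congr_deriv ?_
    rw [deriv_comp_neg, neg_neg, neg_neg, neg_neg]⟩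

/-- The motion behind the wall: after the time `travelTime`, the smooth trajectory comes back to
the wall, and from then on it coincides with the impact trajectory in the first degree of
freedom. -/
theorem IsCutoff.travelTime_shift (hc : IsCutoff (separableField V₁ V₂) Y R χ F G K)
    (hV₁ : ContDiff ℝ 2 V₁) (hV₂ : Differentiable ℝ V₂)
    (hnd : ∀ q, deriv V₁ q = 0 → deriv (deriv V₁) q ≠ 0)
    (hco : Tendsto V₁ (cocompact ℝ) atTop) {e δ : ℝ} (hδ : 0 < δ) (he : V₁ 0 < e)
    (hs : ∀ s ∈ saddles V₁, δ ≤ |e - V₁ s|)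
    (hR : ∀ z, Hint V₁ V₂ z = h → ‖z‖ ≤ R) {z : ℝ → Phase}
    (hz : ∀ t, HasDerivAt z (separableField V₁ V₂ (z t)) t) (hzb : ∀ t, ‖z t‖ ≤ R)
    (hz0 : Hint V₁ V₂ (z 0) = h) (hze : energy V₁ (q₁ (z 0), p₁ (z 0)) = e)
    {t₀ : ℝ} (hq : q₁ (z t₀) = 0) (hp : p₁ (z t₀) < 0) (t : ℝ) :
    q₁ (z (t + travelTime V₁ e)) = q₁ (z (2 * t₀ - t)) ∧
      p₁ (z (t + travelTime V₁ e)) = -p₁ (z (2 * t₀ - t)) := by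
  have hV₁d : Differentiable ℝ V₁ := hV₁.differentiable (by simp)
  obtain ⟨c, hc0, hinf, hVc, g, hg0, hg⟩ := exists_left_turning hV₁ hnd hco hδ he hs
  -- The auxiliary orbit starts at the left turning point; its second pair of coordinates only
  -- serves to stay on the energy level `h`.
  obtain ⟨ζ, hζ0, hζ, hζb⟩ := hc.exists_smooth hV₁d hV₂ hR (a := (-c, 0, q₂ (z 0), p₂ (z 0))) (by
    rw [← hz0, Hint, Hint, hze]
    simp [energy, q₁, p₁, q₂, p₂, hVc])
  have hm := isMotion_of_solution hζ
  obtain ⟨s₀, hs₀, hqs, -, hps, -⟩ := hm.neg.exists_crossing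
    (x := c) (g := g) (hV₁d.comp differentiable_neg) hc0 hg0 hg
    (by simp [hζ0, q₁]) (by simp [hζ0, p₁])
  have hqs' : q₁ (ζ s₀) = 0 := by simpa using hqs
  have hps' : ∀ t ∈ Ioc 0 s₀, 0 < p₁ (ζ t) := fun t ht => by
    have h1 := hps t ⟨ht.1.le, ht.2⟩
    have : 0 < g * t := mul_pos hg0 ht.1
    linarith
  have hζe : energy V₁ (q₁ (ζ 0), p₁ (ζ 0)) = e := by simp [hζ0, energy, q₁, p₁, hVc]
  have htt : travelTime V₁ e = 2 * s₀ :=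
    travelTime_eq hV₁d hm hs₀ hζe hinf hc0 (by simp [hζ0, q₁]) hqs' hps'
  have hpp : p₁ (z t₀) = -p₁ (ζ s₀) := by
    have h1 := (isMotion_of_solution hz).energy_eq hV₁d 0 t₀
    have h2 := hm.energy_eq hV₁d 0 s₀
    rw [hze] at h1
    rw [hζe] at h2
    simp only [energy, hq, hqs'] at h1 h2
    have h3 : p₁ (z t₀) ^ 2 = p₁ (ζ s₀) ^ 2 := by linarith
    rcases sq_eq_sq_iff_eq_or_eq_neg.1 h3 with h4 | h4
    · linarith [hps' s₀ ⟨hs₀, le_rfl⟩]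
    · exact h4
  -- At the wall `ζ` and `z` have opposite first momenta of equal size, so in the first degree of
  -- freedom `z` is `ζ` run backwards.
  have hu : splice (s₀ + t₀) ζ z = z := hc.unique (hasDerivAt_splice _ hζ hz) hz
    (norm_splice_le _ hζb hzb) hzb (t₀ := t₀) (by
      have : s₀ + t₀ - t₀ = s₀ := by ring
      ext <;> simp only [splice, this]
      · exact hqs'.trans hq.symm
      · exact hpp.symm
      · rfl
      · rfl)
  have key : ∀ t, q₁ (z t) = q₁ (ζ (s₀ + t₀ - t)) ∧ p₁ (z t) = -p₁ (ζ (s₀ + t₀ - t)) := fun t => by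
    have := congrFun hu t
    exact ⟨(congrArg q₁ this).symm, (congrArg p₁ this).symm⟩
  -- `ζ` starts at the left turning point, so it is symmetric under time reversal
  have hv : splice 0 ζ ζ = ζ := hc.unique (hasDerivAt_splice _ hζ hζ) hζ
    (norm_splice_le _ hζb hζb) hζb (t₀ := 0) (by
      ext <;> simp [splice, hζ0, q₁, p₁, q₂, p₂])
  have key2 : ∀ t, q₁ (ζ t) = q₁ (ζ (-t)) ∧ p₁ (ζ t) = -p₁ (ζ (-t)) := fun t => by
    have := congrFun hv t
    have h1 := (congrArg q₁ this).symm
    have h2 := (congrArg p₁ this).symm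
    simp only [splice, zero_sub] at h1 h2
    exact ⟨h1, h2⟩
  rw [htt, (key _).1, (key _).2, (key (2 * t₀ - t)).1, (key (2 * t₀ - t)).2]
  have e1 : s₀ + t₀ - (t + 2 * s₀) = -(s₀ + t₀ - (2 * t₀ - t)) := by ring
  rw [e1]
  obtain ⟨k1, k2⟩ := key2 (s₀ + t₀ - (2 * t₀ - t))
  exact ⟨k1.symm, by rw [k2, neg_neg]⟩

end Unperturbed

/-! ### Crossing times of perturbed motions -/

theorem sub_le_of_deriv_le {f f' : ℝ → ℝ} {a b C : ℝ}
    (hf : ∀ t ∈ Icc a b, HasDerivAt f (f' t) t) (hC : ∀ t ∈ Icc a b, f' t ≤ C) ⦃s t : ℝ⦄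
    (hs : a ≤ s) (hst : s ≤ t) (ht : t ≤ b) : f t - f s ≤ C * (t - s) := by
  refine (convex_Icc a b).image_sub_le_mul_sub_of_deriv_le
    (fun x hx => (hf x hx).continuousAt.continuousWithinAt) (fun x hx => ?_) (fun x hx => ?_)
    s ⟨hs, hst.trans ht⟩ t ⟨hs.trans hst, ht⟩ hst
  · exact (hf x (interior_subset hx)).differentiableAt.differentiableWithinAt
  · rw [(hf x (interior_subset hx)).deriv]
    exact hC x (interior_subset hx)

/-- Near time `0` the momentum is too small to survive an error `D`, so `p'` needs its own bound on
`[0, κ]`. Afterwards `p ≤ -(g * κ)` dominates `D`. Since `q ≥ g * κ ^ 2` up to `κ` and `q ≤ -(g * κ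
^ 2)` at `t₀ + κ`, the perturbed crossing lies in between. -/
theorem exists_perturbed_crossing {q p q' p' : ℝ → ℝ} {g κ t₀ D : ℝ} (hg : 0 < g) (hκ : 0 < κ)
    (hκt : 2 * κ ≤ t₀) (hD₁ : 2 * D ≤ g * κ) (hD₂ : D < g * κ ^ 2)
    (hq : ∀ t ∈ Icc 0 (t₀ + κ), HasDerivAt q (p t) t)
    (hq' : ∀ t ∈ Icc 0 (t₀ + κ), HasDerivAt q' (p' t) t)
    (hp : ∀ t ∈ Icc 0 (t₀ + κ), p t ≤ -(g * t)) (hq0 : q t₀ = 0)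
    (hqD : ∀ t ∈ Icc 0 (t₀ + κ), |q' t - q t| ≤ D)
    (hpD : ∀ t ∈ Icc 0 (t₀ + κ), |p' t - p t| ≤ D)
    (hp' : ∀ t ∈ Icc 0 κ, p' t ≤ -(g * t)) :
    ∃ t₁, κ ≤ t₁ ∧ t₁ ≤ t₀ + κ ∧ q' t₁ = 0 ∧ (∀ t ∈ Ico 0 t₁, 0 < q' t) ∧
      (∀ t ∈ Ioc 0 t₁, p' t < 0) ∧ |t₁ - t₀| ≤ D / (g * κ / 2) := by
  have hgκ : 0 < g * κ := mul_pos hg hκ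
  have hps : ∀ t ∈ Icc κ (t₀ + κ), p t ≤ -(g * κ) := fun t ht => by
    have := hp t ⟨hκ.le.trans ht.1, ht.2⟩
    nlinarith [ht.1]
  have hps' : ∀ t ∈ Icc κ (t₀ + κ), p' t ≤ -(g * κ / 2) := fun t ht => by
    have h1 := abs_le.1 (hpD t ⟨hκ.le.trans ht.1, ht.2⟩)
    have h2 := hps t ht
    linarith [h1.2]
  have hqs := @sub_le_of_deriv_le q p κ (t₀ + κ) (-(g * κ)) (fun t (ht : t ∈ Icc κ (t₀ + κ)) =>
    hq t ⟨hκ.le.trans ht.1, ht.2⟩) hps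
  have hqs' := @sub_le_of_deriv_le q' p' κ (t₀ + κ) (-(g * κ / 2)) (fun t (ht : t ∈ Icc κ (t₀ + κ)) =>
    hq' t ⟨hκ.le.trans ht.1, ht.2⟩) hps'
  have hqκ : g * κ ^ 2 ≤ q κ := by
    have h1 := hqs le_rfl (show κ ≤ t₀ by linarith) (by linarith)
    rw [hq0] at h1
    nlinarith
  have hstart : ∀ t ∈ Icc 0 κ, 0 < q' t := fun t ht => by
    have h1 := sub_le_of_deriv_le (C := 0) (fun s (hs : s ∈ Icc 0 κ) =>
      hq s ⟨hs.1, by linarith [hs.2]⟩) (fun s hs => by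
        have := hp s ⟨hs.1, by linarith [hs.2]⟩
        nlinarith [hs.1]) ht.1 ht.2 le_rfl
    have h2 := abs_le.1 (hqD t ⟨ht.1, by linarith [ht.2]⟩)
    linarith [h2.1]
  have hend : q' (t₀ + κ) ≤ 0 := by
    have h1 := hqs (show κ ≤ t₀ by linarith) (show t₀ ≤ t₀ + κ by linarith) le_rfl
    have h2 := abs_le.1 (hqD (t₀ + κ) ⟨by linarith, le_rfl⟩)
    rw [hq0] at h1
    nlinarith [h2.2]
  obtain ⟨t₁, ht₁, hz, hbef⟩ := exists_first_zero (show 0 ≤ t₀ + κ by linarith)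
    (fun t ht => (hq' t ht).continuousAt.continuousWithinAt)
    (hstart 0 ⟨le_rfl, hκ.le⟩) hend
  have hκ₁ : κ ≤ t₁ := by
    by_contra hn
    rw [not_le] at hn
    have := hstart t₁ ⟨ht₁.1.le, hn.le⟩
    linarith
  refine ⟨t₁, hκ₁, ht₁.2, hz, hbef, fun t ht => ?_, ?_⟩
  · rcases le_total t κ with h1 | h1
    · have := hp' t ⟨ht.1.le, h1⟩
      nlinarith [ht.1]
    · have := hps' t ⟨h1, ht.2.trans ht₁.2⟩
      linarith
  · rw [le_div_iff₀ (by positivity)]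
    have h2 := abs_le.1 (hqD t₀ ⟨by linarith, by linarith⟩)
    rw [hq0, sub_zero] at h2
    rcases le_total t₀ t₁ with h1 | h1
    · rw [abs_of_nonneg (sub_nonneg.2 h1)]
      have h3 := hqs' (show κ ≤ t₀ by linarith) h1 ht₁.2
      rw [hz] at h3
      linarith [h2.2]
    · rw [abs_of_nonpos (sub_nonpos.2 h1)]
      have h3 := hqs' hκ₁ h1 (by linarith)
      rw [hz] at h3
      linarith [h2.1]

/-- The momentum stays positive until `2 * t₀ - κ`; at `2 * t₀` it is at most `D`, and a force of at
most `-g` brings it to zero within a further time `κ`. Until then `q'` increases from the wall. -/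
theorem exists_perturbed_return {q' p p' f : ℝ → ℝ} {g κ t₀ t₁ D : ℝ} (hg : 0 < g) (hκ : 0 < κ)
    (hκt : 3 * κ ≤ t₀) (hD : 2 * D ≤ g * κ) (ht₁ : t₁ ≤ t₀ + κ)
    (hq' : ∀ t ∈ Icc t₁ (2 * t₀ + κ), HasDerivAt q' (p' t) t)
    (hp' : ∀ t ∈ Icc t₁ (2 * t₀ + κ), HasDerivAt p' (f t) t)
    (hp : ∀ t ∈ Icc t₁ (2 * t₀ - κ), g * κ ≤ p t) (hp0 : p (2 * t₀) = 0)
    (hpD : ∀ t ∈ Icc t₁ (2 * t₀ + κ), |p' t - p t| ≤ D)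
    (hf : ∀ t ∈ Icc (2 * t₀ - κ) (2 * t₀ + κ), f t ≤ -g) (hq0 : q' t₁ = 0) :
    ∃ r₁, t₁ < r₁ ∧ 2 * t₀ - κ ≤ r₁ ∧ r₁ ≤ 2 * t₀ + κ ∧ p' r₁ = 0 ∧ (∀ t ∈ Ico t₁ r₁, 0 < p' t) ∧
      ∀ t ∈ Ioc t₁ r₁, 0 < q' t := by
  have hgκ : 0 < g * κ := mul_pos hg hκ
  have hps : ∀ t ∈ Icc t₁ (2 * t₀ - κ), 0 < p' t := fun t ht => by
    have h1 := abs_le.1 (hpD t ⟨ht.1, by linarith [ht.2]⟩)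
    have h2 := hp t ht
    linarith [h1.1]
  have hend : p' (2 * t₀ + κ) ≤ 0 := by
    have h1 := sub_le_of_deriv_le (fun t (ht : t ∈ Icc (2 * t₀ - κ) (2 * t₀ + κ)) =>
      hp' t ⟨by linarith [ht.1], ht.2⟩) hf (show 2 * t₀ - κ ≤ 2 * t₀ by linarith)
      (show 2 * t₀ ≤ 2 * t₀ + κ by linarith) le_rfl
    have h2 := abs_le.1 (hpD (2 * t₀) ⟨by linarith, by linarith⟩)
    rw [hp0, sub_zero] at h2
    nlinarith [h2.2]
  obtain ⟨r₁, hr₁, hz, hbef⟩ := exists_first_zero (show t₁ ≤ 2 * t₀ + κ by linarith)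
    (fun t ht => (hp' t ht).continuousAt.continuousWithinAt)
    (hps t₁ ⟨le_rfl, by linarith⟩) hend
  refine ⟨r₁, hr₁.1, ?_, hr₁.2, hz, hbef, fun t ht => ?_⟩
  · by_contra hn
    rw [not_le] at hn
    have := hps r₁ ⟨hr₁.1.le, hn.le⟩
    linarith
  · have hmono : StrictMonoOn q' (Icc t₁ r₁) := by
      refine strictMonoOn_of_deriv_pos (convex_Icc _ _)
        (fun s hs => (hq' s ⟨hs.1, hs.2.trans hr₁.2⟩).continuousAt.continuousWithinAt) fun s hs => ?_
      rw [interior_Icc] at hs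
      rw [(hq' s ⟨hs.1.le, hs.2.le.trans hr₁.2⟩).deriv]
      exact hbef s ⟨hs.1.le, hs.2⟩
    rw [← hq0]
    exact hmono (left_mem_Icc.2 hr₁.1.le) ⟨ht.1.le, ht.2⟩ ht.1

/-! ### The unperturbed orbits of the initial points -/

/-- The smooth unperturbed trajectory of an initial point, with its impact time, and with uniform
bounds. -/
structure IsBaseOrbit (V₁ V₂ : ℝ → ℝ) (R g τ T : ℝ) (a : Phase) (t₀ : ℝ) (z : ℝ → Phase) :
    Prop where
  init : z 0 = a
  sol : ∀ t, HasDerivAt z (separableField V₁ V₂ (z t)) t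
  bound : ∀ t, ‖z t‖ ≤ R
  le_time : τ ≤ t₀
  time_le : t₀ ≤ T
  mom_init : p₁ a = 0
  slope : g ≤ deriv V₁ (q₁ a)
  pos_init : g * τ ^ 2 / 2 ≤ q₁ a
  hit : q₁ (z t₀) = 0
  inside : ∀ t ∈ Ico 0 t₀, 0 < q₁ (z t)
  mom_le : ∀ t ∈ Icc 0 t₀, p₁ (z t) ≤ -(g * t)
  shift : ∀ t, q₁ (z (t + travelTime V₁ (energy V₁ (q₁ a, p₁ a)))) = q₁ (z (2 * t₀ - t)) ∧
    p₁ (z (t + travelTime V₁ (energy V₁ (q₁ a, p₁ a)))) = -p₁ (z (2 * t₀ - t))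

theorem p₁_separableField (V₁ V₂ : ℝ → ℝ) (z : Phase) :
    p₁ (separableField V₁ V₂ z) = -deriv V₁ (q₁ z) := rfl

theorem q₁_separableField (V₁ V₂ : ℝ → ℝ) (z : Phase) :
    q₁ (separableField V₁ V₂ z) = p₁ z := rfl

section Orbits

variable {V₁ V₂ : ℝ → ℝ} {Y F G : Phase → Phase} {R : ℝ} {χ : Phase → ℝ} {K : ℝ≥0}

theorem IsCutoff.norm_sub_le (hc : IsCutoff (separableField V₁ V₂) Y R χ F G K) {z : ℝ → Phase}
    (hz : ∀ t, HasDerivAt z (separableField V₁ V₂ (z t)) t) (hzb : ∀ t, ‖z t‖ ≤ R) (s t : ℝ) :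
    ‖z t - z s‖ ≤ 2 * K * |t - s| :=
  norm_sub_le_of_speed (ε := 0) hc.tame_left hc.tame_right (by simp) (fun t => by
    rw [zero_smul, add_zero, hc.left_eq _ (by linarith [hzb t])]
    exact hz t) s t

theorem exists_isBaseOrbit {r : ℕ} (hr : 3 < r) (hV₁ : IsS3B r V₁) (hV₂ : IsS3B r V₂)
    {h δ ρ : ℝ} (hδ : 0 < δ) (hρ : 0 < ρ) (hh : V₁ 0 ∈ regularEnergies V₁ V₂ δ h)
    (hc : IsCutoff (separableField V₁ V₂) Y R χ F G K)
    (hR : ∀ z, Hint V₁ V₂ z = h → ‖z‖ ≤ R) :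
    ∃ g > 0, ∃ τ > 0, ∃ T, ∀ a ∈ initialPoints V₁ V₂ h δ ρ, ∃ t₀ z,
      IsBaseOrbit V₁ V₂ R g τ T a t₀ z := by
  have hC₁ := hV₁.contDiff_two hr
  have hd₁ : Differentiable ℝ V₁ := hC₁.differentiable (by simp)
  have hd₂ : Differentiable ℝ V₂ := (hV₂.contDiff_two hr).differentiable (by simp)
  obtain ⟨c, hc0, hgap⟩ := exists_energy_gap hr (V₁ := V₁) hV₂ hδ hρ hh
  obtain ⟨g, hg0, hg⟩ := exists_slope_bound hC₁ hV₁.nondegenerate hδ hc0 R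
  have hK : (1 : ℝ) ≤ K := by exact_mod_cast hc.one_le
  -- The momentum must grow from `0` to at least `√(2 * c)` at a rate of at most `2 * K`, which
  -- bounds `t₀` below. From `g * t₀ ^ 2 / 2 ≤ R` and `t₀ ≤ t₀ ^ 2 + 1` comes the upper bound.
  refine ⟨g, hg0, √(2 * c) / (2 * K), by positivity, 2 * R / g + 1, fun a ha => ?_⟩
  have hgap' := hgap a ha
  obtain ⟨hsec, hq0, hE, hw, hreg, -⟩ := ha
  have hp0 : p₁ a = 0 := hsec.1
  set e := energy V₁ (q₁ a, p₁ a) with he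
  have heV : e = V₁ (q₁ a) := by rw [he]; simp [energy, hp0]
  have hsad : ∀ s ∈ saddles V₁, δ ≤ |e - V₁ s| := fun s hs => by
    have h1 := (mem_regularEnergies.1 hreg).2.2.2 s hs
    have h2 : e + energy V₂ (q₂ a, p₂ a) = h := hE
    rw [abs_sub_comm] at h1
    convert h1 using 2
    linarith
  have haR : ‖a‖ ≤ R := hR a hE
  have hqR : q₁ a ≤ R := (le_abs_self _).trans ((abs_q₁_le a).trans haR)
  have hmem : q₁ a ∈ turningPoints V₁ δ c R := by
    refine ⟨⟨hq0.le, hqR⟩, by rwa [← heV], fun s hs => by rw [← heV]; exact hsad s hs,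
      fun θ hθ => ?_⟩
    rw [← heV]
    have hself : q₁ a ∈ well V₁ e (q₁ a) := mem_connectedComponentIn heV.ge
    refine well_subset (uIcc_subset_well hw hself ?_)
    rw [uIcc_of_le hq0.le]
    exact ⟨mul_nonneg hθ.1 hq0.le, mul_le_of_le_one_left hq0.le hθ.2⟩
  have hga := hg _ hmem
  obtain ⟨z, hz0, hz, hzb⟩ := hc.exists_smooth hd₁ hd₂ hR hE
  have hm := isMotion_of_solution hz
  obtain ⟨t₀, ht₀, hhit, hins, hmom, htb⟩ := hm.exists_crossing hd₁ hq0 hg0 hga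
    (by simp [hz0]) (by simp [hz0, hp0])
  have hτ : √(2 * c) / (2 * K) ≤ t₀ := by
    rw [div_le_iff₀ (by positivity)]
    have h1 := hm.energy_eq hd₁ 0 t₀
    simp only [hz0, hhit, energy, hp0] at h1
    have h2 : 2 * c ≤ p₁ (z t₀) ^ 2 := by rw [heV] at hgap'; linarith
    have h3 := (abs_p₁_le _).trans (hc.norm_sub_le hz hzb 0 t₀)
    rw [sub_zero, abs_of_pos ht₀] at h3
    have h4 : p₁ (z t₀ - z 0) = p₁ (z t₀) := by
      have : p₁ (z t₀ - z 0) = p₁ (z t₀) - p₁ (z 0) := rfl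
      rw [this, hz0, hp0, sub_zero]
    rw [h4] at h3
    have h5 := Real.abs_le_sqrt (le_refl (p₁ (z t₀) ^ 2))
    calc √(2 * c) ≤ √(p₁ (z t₀) ^ 2) := Real.sqrt_le_sqrt h2
      _ = |p₁ (z t₀)| := Real.sqrt_sq_eq_abs _
      _ ≤ 2 * K * t₀ := h3
      _ = _ := by ring
  have hτ0 : 0 < √(2 * c) / (2 * K) := by positivity
  refine ⟨t₀, z, hz0, hz, hzb, hτ, ?_, hp0, le_deriv_of_slope_bound (hd₁ _) hq0 hga, ?_, hhit,
    hins, hmom, fun t => ?_⟩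
  · have h1 : t₀ ^ 2 ≤ 2 * R / g := by
      rw [le_div_iff₀ hg0]
      linarith
    nlinarith [sq_nonneg (t₀ - 1)]
  · refine le_trans ?_ htb
    gcongr
  · refine hc.travelTime_shift hC₁ hd₂ hV₁.nondegenerate hV₁.coercive hδ (by linarith) hsad hR hz hzb
      (by rw [hz0]; exact hE) (by rw [hz0]) hhit ?_ t
    have h1 := hmom t₀ (right_mem_Icc.2 ht₀.le)
    have h2 : 0 < g * t₀ := mul_pos hg0 ht₀
    linarith

/-- Smallness of the time step `κ`. -/
structure IsSmallStep (g τ : ℝ) (K : ℝ≥0) (κ : ℝ) : Prop where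
  pos : 0 < κ
  le_one : κ ≤ 1
  le_time : 3 * κ ≤ τ
  mom : (4 * K + g) * κ ≤ g * τ
  force : 8 * K ^ 2 * κ ≤ g
  dist : 8 * K * κ < g * τ ^ 2

theorem exists_isSmallStep {g τ : ℝ} (hg : 0 < g) (hτ : 0 < τ) (K : ℝ≥0) :
    ∃ κ, IsSmallStep g τ K κ := by
  have key : ∀ A B : ℝ, 0 < B → ∀ᶠ κ in 𝓝[>] (0 : ℝ), A * κ < B := fun A B hB =>
    ((by fun_prop : Continuous fun κ : ℝ => A * κ).continuousWithinAt (s := Ioi 0)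
      (x := 0)).eventually_lt_const (by simpa using hB)
  obtain ⟨κ, h0, h1, h2, h3, h4, h5⟩ := ((eventually_mem_nhdsWithin (a := (0 : ℝ)) (s := Ioi 0)).and ((key 1 1 one_pos).and
    ((key 3 τ hτ).and ((key (4 * K + g) (g * τ) (by positivity)).and
    ((key (8 * K ^ 2) g hg).and (key (8 * K) (g * τ ^ 2) (by positivity))))))).exists
  exact ⟨κ, h0, by linarith, h2.le, h3.le, h4.le, h5⟩

section Single

variable {g τ T κ : ℝ} {a : Phase} {t₀ : ℝ} {z : ℝ → Phase}

/-- Behind the wall the momentum changes by at most `2 * K * κ`; the condition `mom` on `κ` absorbs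
this at the price of half the rate. -/
theorem IsBaseOrbit.mom_le_extended (hb : IsBaseOrbit V₁ V₂ R g τ T a t₀ z)
    (hc : IsCutoff (separableField V₁ V₂) Y R χ F G K) (hκ : IsSmallStep g τ K κ) (hg : 0 < g) :
    ∀ t ∈ Icc 0 (t₀ + κ), p₁ (z t) ≤ -(g / 2 * t) := by
  intro t ht
  rcases le_total t t₀ with h1 | h1
  · have := hb.mom_le t ⟨ht.1, h1⟩
    nlinarith [ht.1]
  · have ht₀ : 0 ≤ t₀ := by linarith [hb.le_time, hκ.le_time, hκ.pos]
    have h2 := hb.mom_le t₀ ⟨ht₀, le_rfl⟩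
    have h3 := (abs_p₁_le _).trans (hc.norm_sub_le hb.sol hb.bound t₀ t)
    have h4 : p₁ (z t - z t₀) = p₁ (z t) - p₁ (z t₀) := rfl
    rw [h4, abs_of_nonneg (sub_nonneg.2 h1)] at h3
    have h5 := le_of_abs_le h3
    have h6 : 2 * K * (t - t₀) ≤ 2 * K * κ := by
      have : t - t₀ ≤ κ := by linarith [ht.2]
      gcongr
    have h7 : g / 2 * t ≤ g / 2 * (t₀ + κ) := by have := ht.2; gcongr
    have h8 : g * τ ≤ g * t₀ := by have := hb.le_time; gcongr
    have := hκ.mom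
    nlinarith

theorem splice_self_apply (z : ℝ → Phase) (t₀ : ℝ) :
    splice (2 * t₀) z z t₀ = reflect (z t₀) := by
  have : 2 * t₀ - t₀ = t₀ := by ring
  simp only [splice, reflect, this]

theorem IsBaseOrbit.isImpactTrajectory (hb : IsBaseOrbit V₁ V₂ R g τ T a t₀ z)
    (hc : IsCutoff (separableField V₁ V₂) Y R χ F G K) (hκ : IsSmallStep g τ K κ) (hg : 0 < g) :
    IsImpactTrajectory (separableField V₁ V₂) a t₀ (2 * t₀ + κ) z (splice (2 * t₀) z z) := by
  have hκ0 := hκ.pos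
  have ht₀ : 0 < t₀ := by linarith [hb.le_time, hκ.le_time]
  refine ⟨ht₀, by linarith, hb.init, fun t _ => (hb.sol t).hasDerivWithinAt, hb.inside, hb.hit, ?_,
    splice_self_apply z t₀, fun t _ => (hasDerivAt_splice _ hb.sol hb.sol t).hasDerivWithinAt,
    fun t ht => ?_⟩
  · have h1 := hb.mom_le t₀ ⟨ht₀.le, le_rfl⟩
    have := mul_pos hg ht₀
    linarith
  · change 0 < q₁ (z (2 * t₀ - t))
    rcases le_total t (2 * t₀) with h1 | h1
    · exact hb.inside _ ⟨by linarith, by linarith [ht.1]⟩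
    · have h2 := (abs_q₁_le _).trans (hc.norm_sub_le hb.sol hb.bound 0 (2 * t₀ - t))
      have h3 : q₁ (z (2 * t₀ - t) - z 0) = q₁ (z (2 * t₀ - t)) - q₁ (z 0) := rfl
      rw [h3, hb.init, sub_zero, abs_of_nonpos (a := 2 * t₀ - t) (by linarith)] at h2
      have h4 := neg_le_of_abs_le h2
      have h5 : 2 * K * -(2 * t₀ - t) ≤ 2 * K * κ := by
        have : -(2 * t₀ - t) ≤ κ := by linarith [ht.2]
        gcongr
      have h6 := hκ.dist
      have h7 := hb.pos_init
      have h8 : 0 ≤ K * κ := by positivity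
      linarith

theorem IsBaseOrbit.isReturnTime (hb : IsBaseOrbit V₁ V₂ R g τ T a t₀ z) (hg : 0 < g)
    (ht₀ : 0 < t₀) :
    IsReturnTime (separableField V₁ V₂) t₀ (2 * t₀) z (splice (2 * t₀) z z) := by
  refine ⟨by linarith, ⟨?_, ?_⟩, fun t ht h => ?_, fun t ht h => ?_⟩
  · have : p₁ (splice (2 * t₀) z z (2 * t₀)) = -p₁ (z (2 * t₀ - 2 * t₀)) := rfl
    rw [this, sub_self, hb.init, hb.mom_init, neg_zero]
  · rw [p₁_separableField]
    have : q₁ (splice (2 * t₀) z z (2 * t₀)) = q₁ (z (2 * t₀ - 2 * t₀)) := rfl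
    rw [this, sub_self, hb.init]
    linarith [hb.slope]
  · have h1 := hb.mom_le t ⟨ht.1.le, ht.2⟩
    have h2 := mul_pos hg ht.1
    rw [h.1] at h1
    linarith
  · have h1 := hb.mom_le (2 * t₀ - t) ⟨by linarith [ht.2], by linarith [ht.1]⟩
    have h2 := mul_pos hg (show 0 < 2 * t₀ - t by linarith [ht.2])
    have h3 : -p₁ (z (2 * t₀ - t)) = 0 := h.1
    linarith

variable {ε D : ℝ} {y yp : ℝ → Phase}

/-- The force stays negative near a point of the cross-section. -/
theorem IsCutoff.force_le (hc : IsCutoff (separableField V₁ V₂) Y R χ F G K) {x v : Phase} {d : ℝ}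
    (hx : ‖x‖ ≤ R) (hgx : g ≤ deriv V₁ (q₁ x)) (hd : ‖v - x‖ ≤ d) (hKd : 8 * K * d ≤ 3 * g)
    (hε : 8 * K * |ε| ≤ g) : p₁ (F v + ε • G v) ≤ -(g / 2) := by
  have h1 := (abs_p₁_le _).trans (hc.tame_left.norm_sub_le v x)
  have h2 : p₁ (F v - F x) = p₁ (F v) - p₁ (F x) := rfl
  rw [h2, hc.left_eq x (by linarith), p₁_separableField] at h1
  have h3 := le_of_abs_le h1
  have h4 : p₁ (F v + ε • G v) = p₁ (F v) + ε * p₁ (G v) := rfl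
  have h5 : ε * p₁ (G v) ≤ |ε| * K :=
    (le_abs_self _).trans (by
      rw [abs_mul]
      exact mul_le_mul_of_nonneg_left ((abs_p₁_le _).trans (hc.tame_right.bound v)) (abs_nonneg _))
  have h6 : K * ‖v - x‖ ≤ K * d := by gcongr
  rw [h4]
  linarith

theorem IsCutoff.hasDerivAt_q₁ (hc : IsCutoff (separableField V₁ V₂) Y R χ F G K)
    (hY : ∀ z, q₁ (Y z) = 0)
    (hy : ∀ t, HasDerivAt y (F (y t) + ε • G (y t)) t) {t : ℝ} (hb : ‖y t‖ ≤ R + 1) :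
    HasDerivAt (fun t => q₁ (y t)) (p₁ (y t)) t := by
  have h1 := (hasDerivAt_phase.1 (hy t)).1
  have h2 : q₁ (F (y t) + ε • G (y t)) = q₁ (F (y t)) + ε * q₁ (G (y t)) := rfl
  rwa [h2, hc.left_eq _ hb, hc.right_eq _ hb, hY, mul_zero, add_zero, q₁_separableField] at h1

theorem norm_le_of_close {u v : Phase} {R D : ℝ} (hv : ‖v‖ ≤ R) (h : ‖u - v‖ ≤ D) (hD : D ≤ 1) :
    ‖u‖ ≤ R + 1 := by
  have := norm_le_norm_add_norm_sub' u v
  linarith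

/-- The first impact of a perturbed trajectory. -/
theorem IsBaseOrbit.exists_impact (hb : IsBaseOrbit V₁ V₂ R g τ T a t₀ z)
    (hc : IsCutoff (separableField V₁ V₂) Y R χ F G K) (hκ : IsSmallStep g τ K κ) (hg : 0 < g)
    (hY : ∀ z, q₁ (Y z) = 0) (hε₁ : |ε| ≤ 1) (hε : 8 * K * |ε| ≤ g)
    (hy : ∀ t, HasDerivAt y (F (y t) + ε • G (y t)) t) (hy0 : y 0 = a)
    (hD₁ : D ≤ 1) (hD₂ : 4 * D ≤ g * κ) (hD₃ : 2 * D < g * κ ^ 2)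
    (hyz : ∀ t ∈ Icc 0 (t₀ + κ), ‖y t - z t‖ ≤ D) :
    ∃ t₁, κ ≤ t₁ ∧ t₁ ≤ t₀ + κ ∧ q₁ (y t₁) = 0 ∧ (∀ t ∈ Ico 0 t₁, 0 < q₁ (y t)) ∧
      (∀ t ∈ Ioc 0 t₁, p₁ (y t) < 0) ∧ |t₁ - t₀| ≤ D / (g * κ / 4) := by
  have hκ0 := hκ.pos
  have ht₀ : 3 * κ ≤ t₀ := by linarith [hb.le_time, hκ.le_time]
  have hyb : ∀ t ∈ Icc 0 (t₀ + κ), ‖y t‖ ≤ R + 1 := fun t ht =>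
    norm_le_of_close (hb.bound t) (hyz t ht) hD₁
  have haR : ‖a‖ ≤ R := by rw [← hb.init]; exact hb.bound 0
  obtain ⟨t₁, h1, h2, h3, h4, h5, h6⟩ := exists_perturbed_crossing (g := g / 2) (κ := κ) (t₀ := t₀)
    (D := D) (q := fun t => q₁ (z t)) (p := fun t => p₁ (z t)) (q' := fun t => q₁ (y t))
    (p' := fun t => p₁ (y t)) (by linarith) hκ0 (by linarith) (by linarith) (by linarith)
    (fun t _ => (isMotion_of_solution hb.sol).pos t)
    (fun t ht => hc.hasDerivAt_q₁ hY hy (hyb t ht)) (hb.mom_le_extended hc hκ hg) hb.hit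
    (fun t ht => (abs_q₁_le (y t - z t)).trans (hyz t ht))
    (fun t ht => (abs_p₁_le (y t - z t)).trans (hyz t ht)) (fun t ht => by
      -- The early bound comes from integrating the force from the cross-section, not from
      -- comparison with `z`.
      have h1 := sub_le_of_deriv_le (f := fun t => p₁ (y t)) (a := 0) (b := κ) (C := -(g / 2))
        (fun s _ => (hasDerivAt_phase.1 (hy s)).2.1) (fun s hs => by
          refine hc.force_le haR hb.slope (d := 2 * K * κ) ?_ ?_ hε
          · have h1 := norm_sub_le_of_speed hc.tame_left hc.tame_right hε₁ hy 0 s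
            rw [hy0, sub_zero, abs_of_nonneg hs.1] at h1
            refine h1.trans ?_
            have := hs.2
            gcongr
          · linarith [hκ.force]) le_rfl ht.1 ht.2
      simp only [hy0, hb.mom_init] at h1
      linarith)
  refine ⟨t₁, h1, h2, h3, h4, h5, h6.trans (le_of_eq ?_)⟩
  congr 1
  ring

/-- The return to the cross-section of a perturbed trajectory after its impact. -/
theorem IsBaseOrbit.exists_return (hb : IsBaseOrbit V₁ V₂ R g τ T a t₀ z)
    (hc : IsCutoff (separableField V₁ V₂) Y R χ F G K) (hκ : IsSmallStep g τ K κ) (hg : 0 < g)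
    (hY : ∀ z, q₁ (Y z) = 0) (hε : 8 * K * |ε| ≤ g)
    (hyp : ∀ t, HasDerivAt yp (F (yp t) + ε • G (yp t)) t)
    (hD₁ : D ≤ 1) (hD₂ : 4 * D ≤ g * κ) (hD₃ : 8 * K * D ≤ g) {t₁ : ℝ}
    (ht₁ : |t₁ - t₀| ≤ κ) (hq0 : q₁ (yp t₁) = 0)
    (hyz : ∀ t ∈ Icc t₁ (2 * t₀ + κ), ‖yp t - splice (2 * t₀) z z t‖ ≤ D) :
    ∃ r₁, t₁ < r₁ ∧ r₁ ≤ 2 * t₀ + κ ∧ p₁ (yp r₁) = 0 ∧ p₁ (F (yp r₁) + ε • G (yp r₁)) < 0 ∧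
      (∀ t ∈ Ico t₁ r₁, 0 < p₁ (yp t)) ∧ ∀ t ∈ Ioc t₁ r₁, 0 < q₁ (yp t) := by
  have hκ0 := hκ.pos
  have ht₀ : 3 * κ ≤ t₀ := by linarith [hb.le_time, hκ.le_time]
  rw [abs_le] at ht₁
  have hsb := norm_splice_le (2 * t₀) hb.bound hb.bound
  have hss := hasDerivAt_splice (2 * t₀) hb.sol hb.sol
  have hyb : ∀ t ∈ Icc t₁ (2 * t₀ + κ), ‖yp t‖ ≤ R + 1 := fun t ht =>
    norm_le_of_close (hsb t) (hyz t ht) hD₁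
  have hforce : ∀ t ∈ Icc (2 * t₀ - κ) (2 * t₀ + κ), p₁ (F (yp t) + ε • G (yp t)) ≤ -(g / 2) := by
    intro t ht
    refine hc.force_le (hsb (2 * t₀)) ?_ (d := D + 2 * K * κ) ?_ ?_ hε
    · have : q₁ (splice (2 * t₀) z z (2 * t₀)) = q₁ (z (2 * t₀ - 2 * t₀)) := rfl
      rw [this, sub_self, hb.init]
      exact hb.slope
    · have h1 := hyz t ⟨by linarith [ht.1], ht.2⟩
      have h2 := hc.norm_sub_le hss hsb (2 * t₀) t
      have h3 : |t - 2 * t₀| ≤ κ := abs_le.2 ⟨by linarith [ht.1], by linarith [ht.2]⟩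
      calc ‖yp t - splice (2 * t₀) z z (2 * t₀)‖ = ‖(yp t - splice (2 * t₀) z z t) +
            (splice (2 * t₀) z z t - splice (2 * t₀) z z (2 * t₀))‖ := by congr 1; abel
        _ ≤ D + 2 * K * |t - 2 * t₀| := (norm_add_le _ _).trans (add_le_add h1 h2)
        _ ≤ D + 2 * K * κ := by gcongr
    · have := hκ.force
      nlinarith
  obtain ⟨r₁, h1, h2, h3, h4, h5, h6⟩ := exists_perturbed_return (g := g / 2) (κ := κ) (t₀ := t₀)
    (t₁ := t₁) (D := D) (q' := fun t => q₁ (yp t)) (p := fun t => p₁ (splice (2 * t₀) z z t))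
    (p' := fun t => p₁ (yp t)) (f := fun t => p₁ (F (yp t) + ε • G (yp t))) (by linarith) hκ0 ht₀
    (by linarith) (by linarith) (fun t ht => hc.hasDerivAt_q₁ hY hyp (hyb t ht))
    (fun t _ => (hasDerivAt_phase.1 (hyp t)).2.1) (fun t ht => by
      have h1 := hb.mom_le_extended hc hκ hg (2 * t₀ - t) ⟨by linarith [ht.2], by linarith [ht.1]⟩
      change g / 2 * κ ≤ -p₁ (z (2 * t₀ - t))
      have : g / 2 * κ ≤ g / 2 * (2 * t₀ - t) := by
        have := ht.2
        gcongr
        linarith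
      linarith) (by
      change -p₁ (z (2 * t₀ - 2 * t₀)) = 0
      rw [sub_self, hb.init, hb.mom_init, neg_zero])
    (fun t ht => (abs_p₁_le (yp t - splice (2 * t₀) z z t)).trans (hyz t ht)) hforce hq0
  exact ⟨r₁, h1, h3, h4, (hforce r₁ ⟨h2, h3⟩).trans_lt (by linarith), h5, h6⟩

end Single

end Orbits

/-! ### Uniform expansion of the return map -/

section Main

variable {V₁ V₂ : ℝ → ℝ} {Y F G : Phase → Phase} {R g τ T κ : ℝ} {χ : Phase → ℝ} {K : ℝ≥0}

theorem IsCutoff.solvesOn (hc : IsCutoff (separableField V₁ V₂) Y R χ F G K) {ε : ℝ}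
    {y : ℝ → Phase} (hy : ∀ t, HasDerivAt y (F (y t) + ε • G (y t)) t) {s : Set ℝ}
    (hs : ∀ t ∈ s, ‖y t‖ ≤ R + 1) :
    SolvesOn (fun z => separableField V₁ V₂ z + ε • Y z) s y := fun t ht => by
  have := (hy t).hasDerivWithinAt (s := s)
  rwa [hc.left_eq _ (hs t ht), hc.right_eq _ (hs t ht)] at this

theorem exists_uniform_expansion (hc : IsCutoff (separableField V₁ V₂) Y R χ F G K)
    (hκ : IsSmallStep g τ K κ) (hg : 0 < g) (hτ : 0 < τ) (hY : ∀ z, q₁ (Y z) = 0) :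
    ∃ ε₀ > 0, ∃ C : ℝ, ∀ a t₀ z, IsBaseOrbit V₁ V₂ R g τ T a t₀ z → ∃ w wp : ℝ → Phase,
      w 0 = 0 ∧ (∀ t, HasDerivAt w (fderiv ℝ (separableField V₁ V₂) (z t) (w t) + Y (z t)) t) ∧
      wp t₀ = reflect (w t₀) + (-q₁ (w t₀) / p₁ (z t₀)) •
        (reflect (separableField V₁ V₂ (z t₀)) - separableField V₁ V₂ (splice (2 * t₀) z z t₀)) ∧
      (∀ t, HasDerivAt wp (fderiv ℝ (separableField V₁ V₂) (splice (2 * t₀) z z t) (wp t) +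
        Y (splice (2 * t₀) z z t)) t) ∧
      ∀ ε : ℝ, |ε| < ε₀ → ∃ (t₁ r₁ : ℝ) (y yp : ℝ → Phase),
        IsImpactTrajectory (fun z => separableField V₁ V₂ z + ε • Y z) a t₁ r₁ y yp ∧
        IsReturnTime (fun z => separableField V₁ V₂ z + ε • Y z) t₁ r₁ y yp ∧
        r₁ ≤ 2 * t₀ + κ ∧ |t₁ - t₀| ≤ C * |ε| ∧
        (∀ t ∈ Icc 0 (max t₀ t₁), ‖y t - (z t + ε • w t)‖ ≤ C * ε ^ 2) ∧
        (∀ t ∈ Icc (max t₀ t₁) r₁, ‖yp t - (splice (2 * t₀) z z t + ε • wp t)‖ ≤ C * ε ^ 2) ∧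
        (∀ t ∈ Icc t₁ t₀, ‖yp t - splice (2 * t₀) z z t‖ ≤ C * |ε|) := by
  have hκ0 := hκ.pos
  have hK : (1 : ℝ) ≤ K := by exact_mod_cast hc.one_le
  have hgκ : 0 < g * κ := mul_pos hg hκ0
  -- All constants are fixed before the initial point. `C₁`, `C₂`, `C₃` bound first-order error,
  -- second-order error and impact time; `E₁`, `E₂` are the errors just after the impact, with
  -- impact speed at least `g * τ`; `W` bounds the variation after it; `C₄`, `C₅`, `C₆` are the
  -- later errors.
  obtain ⟨T', hT'⟩ : ∃ T', T' = T + 1 := ⟨_, rfl⟩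
  obtain ⟨C₁, hC₁⟩ : ∃ x : ℝ, x = (0 + K) * Real.exp (K * T') := ⟨_, rfl⟩
  have hC₁0 : 0 ≤ C₁ := by rw [hC₁]; positivity
  obtain ⟨C₂, hC₂⟩ : ∃ x : ℝ, x = (0 + (K * C₁ ^ 2 + K * C₁)) * Real.exp (2 * K * T') := ⟨_, rfl⟩
  have hC₂0 : 0 ≤ C₂ := by rw [hC₂]; positivity
  obtain ⟨C₃, hC₃⟩ : ∃ x : ℝ, x = C₁ / (g * κ / 4) := ⟨_, rfl⟩
  have hC₃0 : 0 ≤ C₃ := by rw [hC₃]; positivity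
  obtain ⟨D, hD⟩ : ∃ x : ℝ, x = C₁ + C₂ + C₃ := ⟨_, rfl⟩
  have hD0 : 0 ≤ D := by rw [hD]; positivity
  obtain ⟨E₁, hE₁⟩ : ∃ x : ℝ, x = 4 * K * D + D := ⟨_, rfl⟩
  have hE₁0 : 0 ≤ E₁ := by rw [hE₁]; positivity
  obtain ⟨E₂, hE₂⟩ : ∃ x : ℝ, x = K * (2 * K * D + (4 * K * D + D) + 1) * D
    + K * (2 * K * D + D + 1) * D + D
    + (K * (2 * K * D + D + 1) * D + D) / (g * τ) * (2 * K) := ⟨_, rfl⟩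
  have hE₂0 : 0 ≤ E₂ := by rw [hE₂]; positivity
  obtain ⟨C₄, hC₄⟩ : ∃ x : ℝ, x = (E₁ + K) * Real.exp (K * T') := ⟨_, rfl⟩
  have hC₄0 : 0 ≤ C₄ := by rw [hC₄]; positivity
  obtain ⟨C₅, hC₅⟩ : ∃ x : ℝ, x = C₄ + E₁ + 4 * K * D := ⟨_, rfl⟩
  have hC₅0 : 0 ≤ C₅ := by rw [hC₅]; positivity
  obtain ⟨W₀, hW₀⟩ : ∃ x : ℝ, x = C₁ + C₁ / (g * τ) * (2 * K) := ⟨_, rfl⟩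
  have hW₀0 : 0 ≤ W₀ := by rw [hW₀]; positivity
  obtain ⟨W, hW⟩ : ∃ x : ℝ, x = (W₀ + K) * Real.exp (K * T') := ⟨_, rfl⟩
  have hW0 : 0 ≤ W := by rw [hW]; positivity
  obtain ⟨C₆, hC₆⟩ : ∃ x : ℝ, x = (E₂ + (K * W ^ 2 + K * W)) * Real.exp (2 * K * T') := ⟨_, rfl⟩
  have hC₆0 : 0 ≤ C₆ := by rw [hC₆]; positivity
  obtain ⟨C, hC⟩ : ∃ x : ℝ, x = D + C₅ + C₆ + 1 := ⟨_, rfl⟩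
  have hC1 : 1 ≤ C := by rw [hC]; linarith
  set η := min 1 (min (g * κ / 4) (min (g * κ ^ 2 / 4) (g / (8 * K)))) with hη
  have hη0 : 0 < η := by rw [hη]; positivity
  refine ⟨η / C, by positivity, C, fun a t₀ z hb => ?_⟩
  have ht₀ : 3 * κ ≤ t₀ := by linarith [hb.le_time, hκ.le_time]
  have ht₀0 : 0 < t₀ := by linarith
  have hT₁ : t₀ + κ - 0 ≤ T' := by linarith [hb.time_le, hκ.le_one]
  have hT₂ : 2 * t₀ + κ - t₀ ≤ T' := by linarith [hb.time_le, hκ.le_one]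
  set zp := splice (2 * t₀) z z with hzp
  have hzpb : ∀ t, ‖zp t‖ ≤ R := norm_splice_le (2 * t₀) hb.bound hb.bound
  have hzps := hasDerivAt_splice (2 * t₀) hb.sol hb.sol
  have hzF : ∀ t, HasDerivAt z (F (z t)) t := fun t => by
    rw [hc.left_eq _ (by linarith [hb.bound t])]; exact hb.sol t
  have hzpF : ∀ t, HasDerivAt zp (F (zp t)) t := fun t => by
    rw [hc.left_eq _ (by linarith [hzpb t])]; exact hzps t
  have hzc : Continuous z := continuous_iff_continuousAt.2 fun t => (hzF t).continuousAt
  have hzpc : Continuous zp := continuous_iff_continuousAt.2 fun t => (hzpF t).continuousAt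
  have hFz : F (z t₀) = separableField V₁ V₂ (z t₀) := hc.left_eq _ (by linarith [hb.bound t₀])
  have hFzp : F (zp t₀) = separableField V₁ V₂ (zp t₀) := hc.left_eq _ (by linarith [hzpb t₀])
  -- The variations do not involve `ε` and are chosen before it.
  obtain ⟨w, hw0, hw⟩ := hc.exists_variation hzc 0 0
  obtain ⟨wp, hwp0, hwp⟩ := hc.exists_variation hzpc t₀ (reflect (w t₀) +
    (-q₁ (w t₀) / p₁ (z t₀)) • (reflect (F (z t₀)) - F (zp t₀)))
  have hmom : g * τ ≤ |p₁ (z t₀)| := by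
    have h1 := hb.mom_le t₀ ⟨ht₀0.le, le_rfl⟩
    have h2 : g * τ ≤ g * t₀ := by have := hb.le_time; gcongr
    exact le_trans (by linarith) (neg_le_abs _)
  have hwb : ∀ t ∈ Icc 0 (t₀ + κ), ‖w t‖ ≤ C₁ := by
    rw [hC₁]
    exact variation_bound hc.one_le hc.tame_left hc.tame_right hw hT₁ le_rfl (by simp [hw0])
  have hwpb : ∀ t ∈ Icc t₀ (2 * t₀ + κ), ‖wp t‖ ≤ W := by
    rw [hW]
    refine variation_bound hc.one_le hc.tame_left hc.tame_right hwp hT₂ hW₀0 ?_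
    have h1 := hwb t₀ ⟨ht₀0.le, by linarith⟩
    have h2 : ‖reflect (F (z t₀)) - F (zp t₀)‖ ≤ 2 * K := by
      refine (norm_sub_le _ _).trans ?_
      rw [norm_reflect]
      linarith [hc.tame_left.bound (z t₀), hc.tame_left.bound (zp t₀)]
    have h3 : |-q₁ (w t₀) / p₁ (z t₀)| ≤ C₁ / (g * τ) := by
      rw [abs_div, abs_neg]
      have := (abs_q₁_le (w t₀)).trans h1
      gcongr
    rw [hwp0, hW₀]
    refine (norm_add_le _ _).trans (add_le_add ((norm_reflect _).trans_le h1) ?_)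
    rw [norm_smul, Real.norm_eq_abs]
    gcongr
  refine ⟨w, wp, hw0, fun t => ?_, by rw [hwp0, hFz, hFzp], fun t => ?_, fun ε hε => ?_⟩
  · rw [← hc.fderiv_eq (hb.bound t), ← hc.right_eq _ (by linarith [hb.bound t])]
    exact hw t
  · rw [← hc.fderiv_eq (hzpb t), ← hc.right_eq _ (by linarith [hzpb t])]
    exact hwp t
  have hCε : C * |ε| < η := by rwa [lt_div_iff₀ (by linarith), mul_comm] at hε
  have hle : ∀ x, x ≤ C → x * |ε| ≤ C * |ε| := fun x hx =>
    mul_le_mul_of_nonneg_right hx (abs_nonneg ε)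
  have hη1 : η ≤ 1 := min_le_left _ _
  have hη2 : η ≤ g * κ / 4 := (min_le_right _ _).trans (min_le_left _ _)
  have hη3 : η ≤ g * κ ^ 2 / 4 :=
    (min_le_right _ _).trans ((min_le_right _ _).trans (min_le_left _ _))
  have hη4 : 8 * K * η ≤ g := by
    have : η ≤ g / (8 * K) :=
      (min_le_right _ _).trans ((min_le_right _ _).trans (min_le_right _ _))
    rw [le_div_iff₀ (by positivity)] at this
    linarith
  have hsmall : ∀ x, x ≤ C → x * |ε| ≤ 1 ∧ 4 * (x * |ε|) ≤ g * κ ∧ 2 * (x * |ε|) < g * κ ^ 2 ∧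
      8 * K * (x * |ε|) ≤ g := fun x hx => by
    have h1 := hle x hx
    have : 0 < g * κ ^ 2 := by positivity
    refine ⟨by linarith, by linarith, by linarith, le_trans ?_ hη4⟩
    have : x * |ε| ≤ η := by linarith
    gcongr
  have hε1 : |ε| ≤ 1 := by simpa using (hsmall 1 hC1).1
  have hε8 : 8 * K * |ε| ≤ g := by simpa using (hsmall 1 hC1).2.2.2
  obtain ⟨y, hy0, hy⟩ := hc.exists_solution hε1 0 a
  have hyz : ∀ t ∈ Icc 0 (t₀ + κ), ‖y t - z t‖ ≤ C₁ * |ε| := by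
    rw [hC₁]
    exact first_order_bound hc.one_le hc.tame_left hc.tame_right hy hzF hT₁ le_rfl
      (by simp [hy0, hb.init])
  have hyzw : ∀ t ∈ Icc 0 (t₀ + κ), ‖y t - (z t + ε • w t)‖ ≤ C₂ * ε ^ 2 := by
    rw [hC₂]
    exact second_order_bound hc.one_le hc.tame_left hc.tame_right hε1 hy hzF hw hT₁ le_rfl hwb
      (by simp [hy0, hb.init, hw0])
  obtain ⟨s1, s2, s3, -⟩ := hsmall C₁ (by rw [hC, hD]; linarith)
  obtain ⟨t₁, hκt₁, ht₁κ, hhit, hins, hmomy, htt⟩ :=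
    hb.exists_impact hc hκ hg hY hε1 hε8 hy hy0 s1 s2 s3 hyz
  have htt' : |t₁ - t₀| ≤ C₃ * |ε| := by
    rw [hC₃, div_mul_eq_mul_div]; exact htt
  have httκ : |t₁ - t₀| ≤ κ := by
    refine htt.trans ?_
    rw [div_le_iff₀ (by positivity)]
    have := hle C₁ (by rw [hC, hD]; linarith)
    linarith
  have hyb : ∀ t ∈ Icc 0 (t₀ + κ), ‖y t‖ ≤ R + 1 := fun t ht =>
    norm_le_of_close (hb.bound t) (hyz t ht) s1
  -- Both `y` and `yp` solve the cut-off equation for all times, so each can be evaluated at `t₀` on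
  -- either side of the impact.
  obtain ⟨yp, hyp1, hyp⟩ := hc.exists_solution hε1 t₁ (reflect (y t₁))
  have ht₀m : t₀ ∈ Icc 0 (t₀ + κ) := ⟨ht₀0.le, by linarith⟩
  have httD : |t₁ - t₀| ≤ D * |ε| := htt'.trans (by
    have : C₃ ≤ D := by rw [hD]; linarith
    gcongr)
  obtain ⟨hi1, hi2⟩ := impact_expansion (zp := zp) (wp := wp) (m := g * τ) hc.tame_left
    hc.tame_right hε1 hy hyp hD0
    (by positivity) ((hyz t₀ ht₀m).trans (by
      have : C₁ ≤ D := by rw [hD]; linarith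
      gcongr)) ((hyzw t₀ ht₀m).trans (by
      have : C₂ ≤ D := by rw [hD]; linarith
      gcongr)) httD (splice_self_apply z t₀) hyp1 hb.hit hhit
    (by rw [hFz, q₁_separableField]) hmom hwp0
  rw [← hE₁] at hi1
  rw [← hE₂] at hi2
  have hypz : ∀ t ∈ Icc t₀ (2 * t₀ + κ), ‖yp t - zp t‖ ≤ C₄ * |ε| := by
    rw [hC₄]
    exact first_order_bound hc.one_le hc.tame_left hc.tame_right hyp hzpF hT₂ hE₁0 hi1
  have hypzw : ∀ t ∈ Icc t₀ (2 * t₀ + κ), ‖yp t - (zp t + ε • wp t)‖ ≤ C₆ * ε ^ 2 := by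
    rw [hC₆]
    exact second_order_bound hc.one_le hc.tame_left hc.tame_right hε1 hyp hzpF hwp hT₂ hE₂0 hwpb hi2
  -- On this window of length `O(ε)` both curves move at bounded speed, so the estimate at `t₀`
  -- carries back.
  have hwin : ∀ t ∈ Icc t₁ t₀, ‖yp t - zp t‖ ≤ (E₁ + 4 * K * D) * |ε| := fun t ht => by
    have h1 := norm_sub_le_of_speed hc.tame_left hc.tame_right hε1 hyp t₀ t
    have h2 := hc.norm_sub_le hzps hzpb t t₀
    have h3 : |t - t₀| ≤ D * |ε| := by
      refine le_trans ?_ httD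
      rw [abs_sub_comm, abs_of_nonneg (by linarith [ht.2]), abs_sub_comm,
        abs_of_nonneg (by linarith [ht.1, ht.2])]
      linarith [ht.1]
    have h4 : 2 * K * |t - t₀| ≤ 2 * K * (D * |ε|) := by gcongr
    rw [abs_sub_comm t₀ t] at h2
    calc ‖yp t - zp t‖ = ‖(yp t - yp t₀) + (yp t₀ - zp t₀) + (zp t₀ - zp t)‖ := by congr 1; abel
      _ ≤ 2 * K * |t - t₀| + E₁ * |ε| + 2 * K * |t - t₀| :=
        (norm_add_le _ _).trans (add_le_add ((norm_add_le _ _).trans (add_le_add h1 hi1)) h2)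
      _ ≤ _ := by linarith
  have hypall : ∀ t ∈ Icc t₁ (2 * t₀ + κ), ‖yp t - zp t‖ ≤ C₅ * |ε| := fun t ht => by
    have hKD : 0 ≤ 4 * K * D := by positivity
    rcases le_total t t₀ with h1 | h1
    · refine (hwin t ⟨ht.1, h1⟩).trans ?_
      have : E₁ + 4 * K * D ≤ C₅ := by rw [hC₅]; linarith
      gcongr
    · refine (hypz t ⟨h1, ht.2⟩).trans ?_
      have : C₄ ≤ C₅ := by rw [hC₅]; linarith
      gcongr
  obtain ⟨u1, u2, -, u4⟩ := hsmall C₅ (by rw [hC]; linarith)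
  have hq0 : q₁ (yp t₁) = 0 := by rw [hyp1]; exact hhit
  obtain ⟨r₁, hr1, hr2, hr3, hr4, hr5, hr6⟩ :=
    hb.exists_return hc hκ hg hY hε8 hyp u1 u2 u4 httκ hq0 hypall
  have hypb : ∀ t ∈ Icc t₁ (2 * t₀ + κ), ‖yp t‖ ≤ R + 1 := fun t ht =>
    norm_le_of_close (hzpb t) (hypall t ht) u1
  have ht₁0 : 0 < t₁ := hκ0.trans_le hκt₁
  have hr₁m : r₁ ∈ Icc t₁ (2 * t₀ + κ) := ⟨hr1.le, hr2⟩
  refine ⟨t₁, r₁, y, yp, ⟨ht₁0, hr1, hy0, ?_, hins, hhit, hmomy t₁ ⟨ht₁0, le_rfl⟩, hyp1, ?_, hr6⟩,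
    ⟨hr1, ⟨hr3, ?_⟩, fun t ht h => ?_, fun t ht h => ?_⟩, hr2, ?_, fun t ht => ?_, fun t ht => ?_,
    fun t ht => ?_⟩
  · exact hc.solvesOn hy fun t ht => hyb t ⟨ht.1, ht.2.trans ht₁κ⟩
  · exact hc.solvesOn hyp fun t ht => hypb t ⟨ht.1, ht.2.trans hr2⟩
  · rwa [hc.left_eq _ (hypb r₁ hr₁m), hc.right_eq _ (hypb r₁ hr₁m)] at hr4
  · exact (hmomy t ht).ne h.1
  · exact (hr5 t ht).ne' h.1
  · exact htt'.trans (hle C₃ (by rw [hC, hD]; linarith))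
  · refine (hyzw t ⟨ht.1, ht.2.trans (max_le (by linarith) ht₁κ)⟩).trans ?_
    have : C₂ ≤ C := by rw [hC, hD]; linarith
    gcongr
  · refine (hypzw t ⟨(le_max_left _ _).trans ht.1, ht.2.trans hr2⟩).trans ?_
    have : C₆ ≤ C := by rw [hC]; linarith
    gcongr
  · refine (hwin t ht).trans (hle _ ?_)
    rw [hC, hC₅]
    linarith

end Main

end ImpactSystem

/-! ### The main theorem. -/

open ImpactSystem
theorem mainTheorem10 (r : ℕ) (hr : 3 < r) (V₁ V₂ : ℝ → ℝ) (Vr : ℝ × ℝ → ℝ)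
    (hV₁ : IsS3B r V₁) (hV₂ : IsS3B r V₂) (hVr : ContDiff ℝ (r + 1) Vr)
    (hwall : RegularWall V₁) (h δ ρ : ℝ) (hδ : 0 < δ) (hρ : 0 < ρ)
    (hh : V₁ 0 ∈ regularEnergies V₁ V₂ δ h) :
    ∃ ε₀ > 0, ∃ C : ℝ, ∀ a ∈ initialPoints V₁ V₂ h δ ρ,
      ∃ (t₀ r₀ T₀ : ℝ) (zm zp wm wp zs ws : ℝ → Phase),
        -- the unperturbed impact trajectory, its return time, and its first variation
        IsImpactTrajectory (hamField (Ham V₁ V₂ Vr 0)) a t₀ T₀ zm zp ∧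
        IsReturnTime (hamField (Ham V₁ V₂ Vr 0)) t₀ r₀ zm zp ∧ r₀ < T₀ ∧
        IsImpactVariation (hamField (Ham V₁ V₂ Vr 0)) (hamField (lift Vr)) t₀ T₀ zm zp wm wp ∧
        -- the unperturbed smooth trajectory and its first variation
        zs 0 = a ∧ SolvesOn (hamField (Ham V₁ V₂ Vr 0)) (Set.Ici 0) zs ∧
        ws 0 = 0 ∧
        SolvesVariationalOn (hamField (Ham V₁ V₂ Vr 0)) (hamField (lift Vr)) (Set.Ici 0) zs ws ∧
        ∀ ε : ℝ, |ε| < ε₀ →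
          ∃ (t₁ r₁ : ℝ) (ym yp : ℝ → Phase),
            -- the perturbed impact trajectory, up to its return time
            IsImpactTrajectory (hamField (Ham V₁ V₂ Vr ε)) a t₁ r₁ ym yp ∧
            IsReturnTime (hamField (Ham V₁ V₂ Vr ε)) t₁ r₁ ym yp ∧ r₁ ≤ T₀ ∧
            |t₁ - t₀| ≤ C * |ε| ∧
            (∀ t ∈ Set.Icc 0 (min t₀ t₁), ‖ym t - (zm t + ε • wm t)‖ ≤ C * ε ^ 2) ∧
            (∀ t ∈ Set.Icc (max t₀ t₁) r₁, ‖yp t - (zp t + ε • wp t)‖ ≤ C * ε ^ 2) ∧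
            (t₀ ≤ t₁ → ∀ t ∈ Set.Icc t₀ t₁, ‖ym t - (zs t + ε • ws t)‖ ≤ C * ε ^ 2) ∧
            (t₁ ≤ t₀ → ∀ t ∈ Set.Icc t₁ t₀,
              ‖yp t - (q₁ (zs (t + travelTime V₁ (energy V₁ (q₁ a, p₁ a)))),
                  p₁ (zs (t + travelTime V₁ (energy V₁ (q₁ a, p₁ a)))),
                  q₂ (zs t), p₂ (zs t))‖ ≤ C * |ε|) := by
  have hd₁ : Differentiable ℝ V₁ := (hV₁.contDiff_two hr).differentiable (by simp)
  have hd₂ : Differentiable ℝ V₂ := (hV₂.contDiff_two hr).differentiable (by simp)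
  have hdr : Differentiable ℝ Vr := hVr.differentiable (by simp)
  have hX : hamField (Ham V₁ V₂ Vr 0) = separableField V₁ V₂ :=
    funext (hamField_Ham_zero hd₁ hd₂)
  have hXε : ∀ ε, hamField (Ham V₁ V₂ Vr ε) =
      fun z => separableField V₁ V₂ z + ε • hamField (lift Vr) z := fun ε => by
    rw [← hX]
    exact funext (hamField_Ham hd₁ hd₂ hdr ε)
  have hn : (2 : WithTop ℕ∞) + 1 ≤ (r : WithTop ℕ∞) + 1 := by
    exact_mod_cast (by omega : 2 + 1 ≤ r + 1)
  have hXc : ContDiff ℝ 2 (separableField V₁ V₂) := by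
    rw [← hX]
    exact contDiff_hamField (contDiff_Ham hV₁.smooth hV₂.smooth hVr 0) hn
  have hYc : ContDiff ℝ 2 (hamField (lift Vr)) := contDiff_hamField (contDiff_lift hVr) hn
  obtain ⟨R, hR0, hR⟩ := exists_energy_bound hV₁ hV₂ h
  obtain ⟨χ, F, G, K, hc⟩ := exists_isCutoff hXc hYc hR0
  obtain ⟨g, hg, τ, hτ, T, horb⟩ := exists_isBaseOrbit hr hV₁ hV₂ hδ hρ hh hc hR
  obtain ⟨κ, hκ⟩ := exists_isSmallStep hg hτ K
  obtain ⟨ε₀, hε₀, C, hmain⟩ :=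
    exists_uniform_expansion (T := T) hc hκ hg hτ (q₁_hamField_lift hdr)
  refine ⟨ε₀, hε₀, C, fun a ha => ?_⟩
  obtain ⟨t₀, z, hb⟩ := horb a ha
  obtain ⟨w, wp, hw0, hw, hjump, hwp, hpert⟩ := hmain a t₀ z hb
  have ht₀ : 0 < t₀ := hτ.trans_le hb.le_time
  -- The same `z` and `w` serve as the part before the impact and as the smooth orbit with its
  -- variation, so one estimate up to `max t₀ t₁` covers both uses.
  refine ⟨t₀, 2 * t₀, 2 * t₀ + κ, z, splice (2 * t₀) z z, w, wp, z, w, ?_, ?_,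
    by linarith [hκ.pos], ?_, hb.init, ?_, hw0, ?_, fun ε hε => ?_⟩
  · rw [hX]; exact hb.isImpactTrajectory hc hκ hg
  · rw [hX]; exact hb.isReturnTime hg ht₀
  · rw [hX]
    exact ⟨hw0, fun t _ => (hw t).hasDerivWithinAt, hjump, fun t _ => (hwp t).hasDerivWithinAt⟩
  · rw [hX]; exact fun t _ => (hb.sol t).hasDerivWithinAt
  · rw [hX]; exact fun t _ => (hw t).hasDerivWithinAt
  obtain ⟨t₁, r₁, y, yp, h1, h2, h3, h4, h5, h6, h7⟩ := hpert ε hε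
  rw [hXε]
  refine ⟨t₁, r₁, y, yp, h1, h2, h3, h4,
    fun t ht => h5 t ⟨ht.1, ht.2.trans (min_le_max)⟩, h6,
    fun _ t ht => h5 t ⟨ht₀.le.trans ht.1, ht.2.trans (le_max_right _ _)⟩, fun _ t ht => ?_⟩
  -- The smooth orbit advanced by the travel time becomes the reflected orbit continued backwards,
  -- `splice (2 * t₀) z z t`.
  rw [(hb.shift t).1, (hb.shift t).2]
  exact h7 t ht
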